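/- Let $\mathcal X$ be a measurable space, $[c]$ a set of $c$ class labels, $\mathscr D$ a probability distribution on $\mathcal X\times[c]$, and $z(x;\theta)\in\mathbb R^c$ the logits of a classifier with parameter $\theta\in\mathbb R^m$, measurable in $x$ and of class $C^2$ in $\theta$. Put $f(x;\theta)=\mathrm{softmax}(z(x;\theta))$, let $\ell(x,y;\theta)=-\log f(x;\theta)_y$ be the cross-entropy loss, $L_{\mathscr D}(\theta)=\mathbb E_{(x,y)\sim\mathscr D}\,\ell(x,y;\theta)$ and, for a sample $S=((x_i,y_i))_{i=1}^n$, $n\ge 1$, drawn i.i.d. from $\mathscr D$, $L_S(\theta)=\frac1n\sum_{i=1}^n\ell(x_i,y_i;\theta)$. With $J_i=\nabla_\theta z(x_i;\theta)\in\mathbb R^{c\times m}$, $f_i=f(x_i;\theta)$ and $e_{y_i}$ the one-hot vector of $y_i$, define $$F_S(\theta)=\frac1n\sum_{i=1}^n J_i^\top\big(\mathrm{diag}(f_i)-f_if_i^\top\big)J_i,\qquad R_S(\theta)=\frac1n\sum_{i=1}^n\sum_{k=1}^c (f_i-e_{y_i})_k\,\nabla^2_\theta z_k(x_i;\theta).$$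 There is an absolute constant $K$ (the $O(1)$ term) such that the following holds. Assume that $|\ell(x,y;\theta)|\le L$ for all $x,y,\theta$, and that $\ell(x,y;\cdot)$ is three times differentiable with all third-order partial derivatives bounded in absolute value by $C$ for all $x,y,\theta$. Let $\xi\in(0,1)$, $\rho>0$ and $\rho=\sqrt m\,\sigma$. Then with probability at least $1-\xi$ over $S$, simultaneously for every $\theta\in\mathbb R^m$ with $L_{\mathscr D}(\theta)\le\mathbb E_{\varepsilon\sim\mathcal N(0,\sigma^2I_m)}L_{\mathscr D}(\theta+\varepsilon)$ and every $\varepsilon_R$ with $\|R_S(\theta)\|\le\varepsilon_R$ (spectral norm), $$L_{\mathscr D}(\theta)\le L_S(\theta)+\frac{\rho^2}{2}\Big(\lambda_{\max}(F_S(\theta))+\varepsilon_R\Big)+\frac{C\,m^{3/2}\rho^3}{6}+\frac{L}{2\sqrt n}\sqrt{m\log\Big(1+\frac{\|\theta\|^2}{\rho^2}\Big)+2\log\frac1\xi+4\log(n+m)+K}.$$ -/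

import Mathlib

open MeasureTheory ProbabilityTheory

noncomputable section

namespace FIMBound

/-- The softmax of a logit vector. -/
def softmax {c : ℕ} (u : Fin c → ℝ) (k : Fin c) : ℝ :=
  Real.exp (u k) / ∑ j, Real.exp (u j)

/-- Cross-entropy loss `-log p(y | x; θ)` of the softmax classifier with logits `z`. -/
def loss {X : Type*} {m c : ℕ} (z : X → EuclideanSpace ℝ (Fin m) → Fin c → ℝ)
    (p : X × Fin c) (θ : EuclideanSpace ℝ (Fin m)) : ℝ :=
  -Real.log (softmax (z p.1 θ) p.2)

/-- Expected loss under the data distribution. -/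
def popLoss {X : Type*} [MeasurableSpace X] {m c : ℕ}
    (z : X → EuclideanSpace ℝ (Fin m) → Fin c → ℝ) (D : Measure (X × Fin c))
    (θ : EuclideanSpace ℝ (Fin m)) : ℝ :=
  ∫ p, loss z p θ ∂D

/-- Empirical loss on the sample `S`. -/
def empLoss {X : Type*} {m c n : ℕ} (z : X → EuclideanSpace ℝ (Fin m) → Fin c → ℝ)
    (S : Fin n → X × Fin c) (θ : EuclideanSpace ℝ (Fin m)) : ℝ :=
  (1 / (n : ℝ)) * ∑ i, loss z (S i) θ

/-- The standard basis vector of the parameter space. -/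
abbrev stdBasis {m : ℕ} (i : Fin m) : EuclideanSpace ℝ (Fin m) :=
  EuclideanSpace.single i (1 : ℝ)

/-- Third-order partial derivative of `g` at `θ` in the coordinates `i`, `j`, `k`. -/
def thirdPartial {m : ℕ} (g : EuclideanSpace ℝ (Fin m) → ℝ) (θ : EuclideanSpace ℝ (Fin m))
    (i j k : Fin m) : ℝ :=
  iteratedFDeriv ℝ 3 g θ ![stdBasis i, stdBasis j, stdBasis k]

/-- Hessian matrix of `g` at `θ`. -/
def hessian {m : ℕ} (g : EuclideanSpace ℝ (Fin m) → ℝ) (θ : EuclideanSpace ℝ (Fin m)) :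
    Matrix (Fin m) (Fin m) ℝ :=
  Matrix.of fun i j => iteratedFDeriv ℝ 2 g θ ![stdBasis i, stdBasis j]

/-- Jacobian (with respect to the parameters) of the logits at the input `x`. -/
def jacobian {X : Type*} {m c : ℕ} (z : X → EuclideanSpace ℝ (Fin m) → Fin c → ℝ)
    (x : X) (θ : EuclideanSpace ℝ (Fin m)) : Matrix (Fin c) (Fin m) ℝ :=
  Matrix.of fun k j => fderiv ℝ (fun θ' => z x θ' k) θ (stdBasis j)

open scoped Matrix in
/-- Empirical Fisher information matrix
`(1/n) ∑ᵢ Jᵢᵀ (diag(fᵢ) - fᵢ fᵢᵀ) Jᵢ`. -/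
def fisher {X : Type*} {m c n : ℕ} (z : X → EuclideanSpace ℝ (Fin m) → Fin c → ℝ)
    (S : Fin n → X × Fin c) (θ : EuclideanSpace ℝ (Fin m)) : Matrix (Fin m) (Fin m) ℝ :=
  (1 / (n : ℝ)) • ∑ i, (jacobian z (S i).1 θ)ᵀ *
    (Matrix.diagonal (softmax (z (S i).1 θ)) -
      Matrix.vecMulVec (softmax (z (S i).1 θ)) (softmax (z (S i).1 θ))) *
    jacobian z (S i).1 θ

/-- Hessian residual `(1/n) ∑ᵢ ∑ₖ (fᵢ - yᵢ)ₖ ∇² zₖ(xᵢ; θ)`, with one-hot labels `yᵢ`. -/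
def residual {X : Type*} {m c n : ℕ} (z : X → EuclideanSpace ℝ (Fin m) → Fin c → ℝ)
    (S : Fin n → X × Fin c) (θ : EuclideanSpace ℝ (Fin m)) : Matrix (Fin m) (Fin m) ℝ :=
  (1 / (n : ℝ)) • ∑ i, ∑ k,
    (softmax (z (S i).1 θ) k - (Pi.single (S i).2 1 : Fin c → ℝ) k) •
      hessian (fun θ' => z (S i).1 θ' k) θ

/-- Largest eigenvalue of a (symmetric) real matrix. -/
def lambdaMax {m : ℕ} (A : Matrix (Fin m) (Fin m) ℝ) : ℝ :=
  sSup (spectrum ℝ A)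

/-- Spectral norm: the operator norm with respect to the Euclidean norm. -/
def specNorm {m : ℕ} (A : Matrix (Fin m) (Fin m) ℝ) : ℝ :=
  ‖Matrix.toEuclideanCLM (𝕜 := ℝ) A‖

/-- The isotropic Gaussian `N(0, σ² I_m)`. -/
def isoGaussian (m : ℕ) (σ : ℝ) : Measure (EuclideanSpace ℝ (Fin m)) :=
  multivariateGaussian 0 (σ ^ 2 • (1 : Matrix (Fin m) (Fin m) ℝ))

end FIMBound

end

/-!
The proof is a PAC-Bayes argument for the Gaussian posterior `N(θ, s² I)`, followed by a
second-order expansion of the empirical loss under Gaussian perturbations of `θ`.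

*Generalization.* The loss takes values in `[0, L]`, so by Hoeffding's lemma the generalization gap
at a fixed parameter has exponential moments at most `exp (t² L² / (8 n))`. Markov's inequality and
Fubini's theorem carry this over to averages over a prior, and a union bound to the finitely many
priors `N(0, s² exp(j / m) I)`, `j < 4 n + 6`
(`exists_event_log_integral_exp_gap_le`). The Donsker–Varadhan inequality
(`integral_pi_gaussian_le_log_integral_exp_add`) passes from a prior to the posterior, at a cost of
at most `j / 2` for the prior that fits `‖θ‖`; the fit costs only an additive constant under the
square root (`exists_event_integral_gap_le`). If no prior in the list fits, then
`m log (1 + ‖θ‖² / ρ²) ≥ 4 n`, and the last term of the bound already exceeds `L`.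

*Expansion.* With third-order partials bounded by `C`, the average of a function over `N(θ, s² I)`
is its value at `θ` plus `s² / 2` times the trace of its Hessian, up to
`C s³ E(∑ |gᵢ|)³ / 6` for a standard Gaussian vector `g` (`abs_integral_gaussian_sub_le`). The
Hessian of the cross-entropy loss is the Fisher part plus the residual part
(`iteratedFDeriv_two_loss`), and the trace of an `m × m` matrix is at most `m` times its largest
eigenvalue or its norm.

*The constant of the third-order term.* The claimed term corresponds to `E(∑ |gᵢ|)³ ≤ m³`. The
estimate `E(∑ |gᵢ|)³ ≤ (4 / 5) (m³ + m²)` of `integral_cube_sum_abs_le` gives this for `m ≥ 4`, and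
there `s = σ`. For `m = 1` it is false. For `m ≤ 3` the posterior therefore has width `s = σ / 2`,
which reduces the error; what is lost is that the hypothesis on `θ` concerns the width `σ`.
Eliminating the trace of the Hessian from the expansions at the two widths turns this hypothesis
into one for the width `σ / 2`, again up to a third-order term
(`popLoss_le_integral_smoothedLoss_half`), and the total error is half of
`C σ³ E(∑ |gᵢ|)³ / 6`. Halving the width raises `m log (1 + ‖θ‖² / ρ²)` only by
`m log 4 ≤ 3 log 4`.
-/

noncomputable section

namespace FIMBound

open scoped ENNReal NNReal

/-! ### Gaussian measures: density ratios and moments -/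

theorem pi_withDensity {ι : Type*} [Fintype ι] {α : ι → Type*} [∀ i, MeasurableSpace (α i)]
    (μ : ∀ i, Measure (α i)) [∀ i, IsProbabilityMeasure (μ i)] (f : ∀ i, α i → ℝ≥0∞)
    (hf : ∀ i, Measurable (f i)) [∀ i, SigmaFinite ((μ i).withDensity (f i))] :
    Measure.pi (fun i => (μ i).withDensity (f i)) =
      (Measure.pi μ).withDensity (fun x => ∏ i, f i (x i)) := by
  refine Measure.pi_eq fun s hs => ?_
  have hbox : MeasurableSet (Set.univ.pi s) := MeasurableSet.univ_pi hs
  have hind : ∀ x : ∀ i, α i, (Set.univ.pi s).indicator (fun x => ∏ i, f i (x i)) x =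
      ∏ i, (s i).indicator (f i) (x i) := by
    intro x
    by_cases hx : x ∈ Set.univ.pi s
    · rw [Set.indicator_of_mem hx]
      exact Finset.prod_congr rfl fun i _ => by
        rw [Set.indicator_of_mem (hx i (Set.mem_univ i))]
    · rw [Set.indicator_of_notMem hx]
      simp only [Set.mem_univ_pi, not_forall] at hx
      obtain ⟨i, hi⟩ := hx
      exact (Finset.prod_eq_zero (Finset.mem_univ i) (Set.indicator_of_notMem hi _)).symm
  have hindep := iIndepFun_pi (μ := μ) (X := fun i => (s i).indicator (f i))
    (fun i => ((hf i).indicator (hs i)).aemeasurable)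
  rw [withDensity_apply _ hbox, ← lintegral_indicator hbox, lintegral_congr hind,
    lintegral_prod_eq_prod_lintegral_of_indepFun Finset.univ
      (fun i (x : ∀ i, α i) => (s i).indicator (f i) (x i)) hindep
      (fun i => ((hf i).indicator (hs i)).comp (measurable_pi_apply i))]
  refine Finset.prod_congr rfl fun i _ => ?_
  rw [withDensity_apply _ (hs i), ← lintegral_indicator (hs i),
    ← (measurePreserving_eval μ i).lintegral_comp ((hf i).indicator (hs i))]

/-- Logarithm of the density of `N(a, v)` with respect to `N(0, v')`. -/
def gaussianLogRatio (a : ℝ) (v v' : ℝ≥0) (x : ℝ) : ℝ :=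
  Real.log (v' / v) / 2 - (x - a) ^ 2 / (2 * v) + x ^ 2 / (2 * v')

theorem gaussianReal_eq_withDensity_gaussianReal (a : ℝ) {v v' : ℝ≥0} (hv : v ≠ 0)
    (hv' : v' ≠ 0) :
    gaussianReal 0 v' = (gaussianReal a v).withDensity
      (fun x => ENNReal.ofReal (Real.exp (-gaussianLogRatio a v v' x))) := by
  have h1 : (0 : ℝ) < v := by positivity
  have h2 : (0 : ℝ) < v' := by positivity
  have hm : Measurable fun x =>
      ENNReal.ofReal (Real.exp (-gaussianLogRatio a v v' x)) := by
    unfold gaussianLogRatio; fun_prop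
  rw [gaussianReal_of_var_ne_zero _ hv', gaussianReal_of_var_ne_zero _ hv,
    ← withDensity_mul _ (measurable_gaussianPDF a v) hm]
  congr 1
  ext x
  rw [Pi.mul_apply, gaussianPDF, gaussianPDF,
    ← ENNReal.ofReal_mul (gaussianPDFReal_nonneg _ _ _)]
  congr 1
  have hs : Real.exp (-(Real.log (v' / v) / 2)) = Real.sqrt v / Real.sqrt v' := by
    rw [← Real.log_sqrt (by positivity), Real.exp_neg, Real.exp_log (by positivity),
      Real.sqrt_div (by positivity), inv_div]
  have he : -gaussianLogRatio a v v' x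
      = -(Real.log (v' / v) / 2) + ((x - a) ^ 2 / (2 * v) + -(x ^ 2 / (2 * v'))) := by
    unfold gaussianLogRatio; ring
  rw [he, Real.exp_add, Real.exp_add, hs, gaussianPDFReal, gaussianPDFReal, sub_zero,
    neg_div, neg_div, Real.exp_neg ((x - a) ^ 2 / (2 * v)),
    Real.sqrt_mul (show 0 ≤ 2 * Real.pi by positivity) v,
    Real.sqrt_mul (show 0 ≤ 2 * Real.pi by positivity) v']
  have := Real.sqrt_pos.2 h1
  have := Real.sqrt_pos.2 h2
  field_simp

theorem integral_sq_gaussianReal (a b : ℝ) (v : ℝ≥0) :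
    Integrable (fun x => (x - b) ^ 2) (gaussianReal a v) ∧
      ∫ x, (x - b) ^ 2 ∂(gaussianReal a v) = v + (a - b) ^ 2 := by
  have hid : MemLp (fun x : ℝ => x) 2 (gaussianReal a v) :=
    memLp_id_gaussianReal (μ := a) (v := v) 2
  have hb : MemLp (fun x : ℝ => x - b) 2 (gaussianReal a v) := hid.sub (memLp_const b)
  refine ⟨hb.integrable_sq, ?_⟩
  have hvar := variance_eq_sub hb
  have h1 : Var[fun x : ℝ => x - b; gaussianReal a v] = v := by
    rw [variance_sub_const hid.aestronglyMeasurable, variance_fun_id_gaussianReal]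
  have h2 : ∫ x, (x - b) ∂(gaussianReal a v) = a - b := by
    rw [integral_sub (hid.integrable (by norm_num)) (integrable_const b),
      integral_id_gaussianReal]
    simp
  rw [h1, h2] at hvar
  simp only [Pi.pow_apply] at hvar
  linarith

theorem integral_gaussianLogRatio (a : ℝ) {v v' : ℝ≥0} (hv : v ≠ 0) :
    Integrable (gaussianLogRatio a v v') (gaussianReal a v) ∧
      ∫ x, gaussianLogRatio a v v' x ∂(gaussianReal a v)
        = Real.log (v' / v) / 2 - 1 / 2 + (v + a ^ 2) / (2 * v') := by
  have h1 : (v : ℝ) ≠ 0 := by exact_mod_cast hv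
  obtain ⟨i1, e1⟩ := integral_sq_gaussianReal a a v
  obtain ⟨i2, e2⟩ := integral_sq_gaussianReal a 0 v
  simp only [sub_zero, sub_self] at i2 e2 e1
  have i1' := (integrable_const (μ := gaussianReal a v) (Real.log (v' / v) / 2)).sub
    (i1.div_const (2 * (v : ℝ)))
  have i2' := i2.div_const (2 * (v' : ℝ))
  refine ⟨i1'.add i2', ?_⟩
  have : ∫ x, gaussianLogRatio a v v' x ∂(gaussianReal a v)
      = (∫ _, Real.log (v' / v) / 2 ∂(gaussianReal a v)
        - ∫ x, (x - a) ^ 2 / (2 * (v : ℝ)) ∂(gaussianReal a v))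
        + ∫ x, x ^ 2 / (2 * (v' : ℝ)) ∂(gaussianReal a v) := by
    rw [← integral_sub (integrable_const _) (i1.div_const _)]
    exact integral_add i1' i2'
  rw [this, integral_div (2 * (v : ℝ)), integral_div (2 * (v' : ℝ)), e1, e2, integral_const]
  simp
  field_simp

/-- The Donsker–Varadhan inequality for a Gaussian posterior `N(a, v I)` and a centred Gaussian
prior `N(0, v' I)`, with the Kullback–Leibler divergence written out. It is Jensen's inequality
for `exp` after changing the measure from the prior to the posterior. -/
theorem integral_pi_gaussian_le_log_integral_exp_add {m : ℕ} (a : Fin m → ℝ) {v v' : ℝ≥0}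
    (hv : v ≠ 0) (hv' : v' ≠ 0) (g : (Fin m → ℝ) → ℝ) (hg : Measurable g) (M : ℝ)
    (hM : ∀ x, |g x| ≤ M) :
    ∫ x, g x ∂(Measure.pi fun i => gaussianReal (a i) v) ≤
      Real.log (∫ x, Real.exp (g x) ∂(Measure.pi fun _ : Fin m => gaussianReal 0 v')) +
      (m * (Real.log (v' / v) / 2 - 1 / 2) + (m * v + ∑ i, a i ^ 2) / (2 * v')) := by
  set Q := Measure.pi fun i => gaussianReal (a i) v with hQ
  set P := Measure.pi fun _ : Fin m => gaussianReal 0 v' with hP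
  set H : (Fin m → ℝ) → ℝ := fun x => ∑ i, gaussianLogRatio (a i) v v' (x i) with hH
  have hPQ : P = Q.withDensity (fun x => ENNReal.ofReal (Real.exp (-H x))) := by
    have hmeas : ∀ i, Measurable fun x =>
        ENNReal.ofReal (Real.exp (-gaussianLogRatio (a i) v v' x)) := fun i => by
      unfold gaussianLogRatio; fun_prop
    have : ∀ i, SigmaFinite ((gaussianReal (a i) v).withDensity fun x =>
        ENNReal.ofReal (Real.exp (-gaussianLogRatio (a i) v v' x))) := fun i => by
      rw [← gaussianReal_eq_withDensity_gaussianReal (a i) hv hv']; infer_instance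
    have := pi_withDensity (fun i => gaussianReal (a i) v) _ hmeas
    simp_rw [← gaussianReal_eq_withDensity_gaussianReal _ hv hv'] at this
    rw [hP, this]
    congr 1
    ext x
    rw [← ENNReal.ofReal_prod_of_nonneg (fun i _ => (Real.exp_pos _).le), ← Real.exp_sum,
      Finset.sum_neg_distrib]
  have hHm : Measurable H := by
    simp only [hH]; unfold gaussianLogRatio; fun_prop
  have hHi : Integrable H Q :=
    integrable_finsetSum _ fun i _ => integrable_comp_eval (integral_gaussianLogRatio (a i) hv).1
  have hHint : ∫ x, H x ∂Q
      = m * (Real.log (v' / v) / 2 - 1 / 2) + (m * v + ∑ i, a i ^ 2) / (2 * v') := by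
    simp only [hH]
    rw [integral_finsetSum _ fun i _ =>
      integrable_comp_eval (integral_gaussianLogRatio (a i) hv).1]
    have : ∀ i, ∫ x : Fin m → ℝ, gaussianLogRatio (a i) v v' (x i) ∂Q
        = Real.log (v' / v) / 2 - 1 / 2 + (v + a i ^ 2) / (2 * v') := fun i => by
      rw [← (integral_gaussianLogRatio (a i) hv).2]
      exact integral_comp_eval (μ := fun i => gaussianReal (a i) v)
        (integral_gaussianLogRatio (a i) hv).1.aestronglyMeasurable
    refine (Finset.sum_congr rfl fun i _ => this i).trans ?_
    rw [Finset.sum_add_distrib, ← Finset.sum_div, Finset.sum_add_distrib]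
    simp
    ring
  have hgi : Integrable g Q :=
    Integrable.of_bound hg.aestronglyMeasurable M (ae_of_all _ hM)
  have hegP : Integrable (fun x => Real.exp (g x)) P :=
    Integrable.of_bound (by fun_prop) (Real.exp M) (ae_of_all _ fun x => by
      rw [Real.norm_eq_abs, Real.abs_exp]
      exact Real.exp_le_exp.2 ((le_abs_self _).trans (hM x)))
  have hdm : Measurable fun x => (Real.exp (-H x)).toNNReal := by fun_prop
  have hsm : ∀ x, (Real.exp (-H x)).toNNReal • Real.exp (g x) = Real.exp (g x - H x) := by
    intro x
    rw [NNReal.smul_def, Real.coe_toNNReal _ (Real.exp_pos _).le, smul_eq_mul, ← Real.exp_add]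
    congr 1; ring
  have hPQ' : P = Q.withDensity (fun x => ((Real.exp (-H x)).toNNReal : ℝ≥0∞)) := hPQ
  have hint : Integrable (fun x => Real.exp (g x - H x)) Q := by
    rw [hPQ', integrable_withDensity_iff_integrable_smul hdm] at hegP
    exact hegP.congr (ae_of_all _ hsm)
  have hch : ∫ x, Real.exp (g x) ∂P = ∫ x, Real.exp (g x - H x) ∂Q := by
    rw [hPQ', integral_withDensity_eq_integral_smul hdm]
    exact integral_congr_ae (ae_of_all _ hsm)
  have hJ : Real.exp (∫ x, (g x - H x) ∂Q) ≤ ∫ x, Real.exp (g x - H x) ∂Q :=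
    convexOn_exp.map_integral_le Real.continuous_exp.continuousOn isClosed_univ
      (ae_of_all _ fun _ => Set.mem_univ _) (hgi.sub hHi) hint
  have hlog := Real.log_le_log (Real.exp_pos _) hJ
  rw [Real.log_exp, integral_sub hgi hHi, hHint, ← hch] at hlog
  linarith

open scoped MatrixOrder in
theorem isoGaussian_eq_map (m : ℕ) {σ : ℝ} (hσ : 0 ≤ σ) :
    isoGaussian m σ = (Measure.pi fun _ : Fin m => gaussianReal 0 1).map
      (fun x => σ • WithLp.toLp 2 x) := by
  have hsq : CFC.sqrt (σ ^ 2 • (1 : Matrix (Fin m) (Fin m) ℝ)) = σ • 1 := by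
    have h0 : (0 : Matrix (Fin m) (Fin m) ℝ) ≤ σ • 1 :=
      (Matrix.PosSemidef.one.smul hσ).nonneg
    rw [CFC.sqrt_eq_iff _ _ ?_ h0]
    · rw [smul_mul_smul_comm, one_mul, sq]
    · exact (Matrix.PosSemidef.one.smul (sq_nonneg σ)).nonneg
  rw [isoGaussian, multivariateGaussian, hsq, ← map_pi_eq_stdGaussian,
    Measure.map_map (by fun_prop) (by fun_prop)]
  congr 1
  ext x : 1
  simp

theorem integral_isoGaussian {m : ℕ} {σ : ℝ} (hσ : 0 ≤ σ) {F : EuclideanSpace ℝ (Fin m) → ℝ}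
    (hF : Measurable F) :
    ∫ ε, F ε ∂(isoGaussian m σ) =
      ∫ x, F (σ • WithLp.toLp 2 x) ∂(Measure.pi fun _ : Fin m => gaussianReal 0 1) := by
  rw [isoGaussian_eq_map m hσ, integral_map (by fun_prop) hF.aestronglyMeasurable]

theorem integral_pi_gaussianReal_eq_standard {m : ℕ} (a : Fin m → ℝ) (s : ℝ≥0)
    {F : (Fin m → ℝ) → ℝ} (hF : Measurable F) :
    ∫ x, F x ∂(Measure.pi fun i => gaussianReal (a i) (s ^ 2)) =
      ∫ x, F (fun i => a i + s * x i) ∂(Measure.pi fun _ : Fin m => gaussianReal 0 1) := by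
  have h1 : ∀ i, (gaussianReal 0 1).map (fun x => a i + s * x) = gaussianReal (a i) (s ^ 2) := by
    intro i
    have : (fun x => a i + s * x) = (fun x => a i + x) ∘ (fun x => (s : ℝ) * x) := rfl
    rw [this, ← Measure.map_map (by fun_prop) (by fun_prop), gaussianReal_map_const_mul,
      gaussianReal_map_const_add]
    congr 1
    · simp
    · ext; simp
  have h2 := Measure.pi_map_pi (μ := fun _ : Fin m => gaussianReal 0 1)
    (f := fun i x => a i + s * x) (fun i => by fun_prop)
  simp_rw [h1] at h2
  have hm : Measurable fun (x : Fin m → ℝ) i => a i + s * x i :=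
    measurable_pi_lambda _ fun i => by fun_prop
  rw [← h2, integral_map hm.aemeasurable hF.aestronglyMeasurable]

theorem integral_abs_pow_gaussianReal (k : ℕ) :
    ∫ x, |x| ^ k ∂(gaussianReal 0 1) =
      2 * (Real.sqrt (2 * Real.pi))⁻¹ *
        ((1 / 2 : ℝ) ^ (-((k : ℝ) + 1) / 2) * (1 / 2) * Real.Gamma (((k : ℝ) + 1) / 2)) := by
  rw [integral_gaussianReal_eq_integral_smul (by norm_num)]
  have h1 : ∀ x : ℝ, gaussianPDFReal 0 1 x • |x| ^ k =
      (fun y : ℝ => (Real.sqrt (2 * Real.pi))⁻¹ * (y ^ (k : ℝ) * Real.exp (-(1 / 2) * y ^ (2 : ℝ))))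
        |x| := by
    intro x
    have : |x| ^ (2 : ℝ) = x ^ 2 := by
      rw [show (2 : ℝ) = ((2 : ℕ) : ℝ) by norm_num, Real.rpow_natCast, sq_abs]
    simp only [gaussianPDFReal, smul_eq_mul, this, Real.rpow_natCast]
    simp
    ring_nf
  rw [integral_congr_ae (ae_of_all _ h1), integral_comp_abs (f := fun y : ℝ =>
      (Real.sqrt (2 * Real.pi))⁻¹ * (y ^ (k : ℝ) * Real.exp (-(1 / 2) * y ^ (2 : ℝ)))),
    integral_const_mul,
    integral_rpow_mul_exp_neg_mul_rpow (by norm_num) (by linarith [k.cast_nonneg (α := ℝ)])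
      (by norm_num)]
  ring

theorem two_mul_inv_sqrt_two_pi_le : 2 * (Real.sqrt (2 * Real.pi))⁻¹ ≤ 4 / 5 := by
  have : (5 / 2 : ℝ) ≤ Real.sqrt (2 * Real.pi) :=
    Real.le_sqrt_of_sq_le (by nlinarith [Real.pi_gt_d2])
  rw [← div_eq_mul_inv, div_le_iff₀ (by linarith)]
  linarith

theorem integral_abs_gaussianReal_le : ∫ x, |x| ∂(gaussianReal 0 1) ≤ 4 / 5 := by
  have h := integral_abs_pow_gaussianReal 1
  simp only [pow_one] at h
  rw [h]
  norm_num [Real.rpow_neg_one]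
  simpa using two_mul_inv_sqrt_two_pi_le

theorem integral_abs_pow_three_gaussianReal_le : ∫ x, |x| ^ 3 ∂(gaussianReal 0 1) ≤ 8 / 5 := by
  rw [integral_abs_pow_gaussianReal 3]
  have h1 : Real.Gamma (((3 : ℕ) + 1 : ℝ) / 2) = 1 := by norm_num
  have h2 : (1 / 2 : ℝ) ^ (-(((3 : ℕ) : ℝ) + 1) / 2) = 4 := by
    rw [show (-(((3 : ℕ) : ℝ) + 1) / 2) = ((-2 : ℤ) : ℝ) by norm_num, Real.rpow_intCast]
    norm_num
  rw [h1, h2]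
  linarith [two_mul_inv_sqrt_two_pi_le]

theorem integrable_abs_pow_gaussianReal (k : ℕ) :
    Integrable (fun x : ℝ => |x| ^ k) (gaussianReal 0 1) := by
  have := (memLp_id_gaussianReal (μ := 0) (v := 1) k).integrable_norm_pow'
  simpa using this

theorem integral_abs_mul_sq_pi_gaussian {m : ℕ} (i k : Fin m) :
    Integrable (fun x : Fin m → ℝ => |x i| * x k ^ 2)
      (Measure.pi fun _ : Fin m => gaussianReal 0 1) ∧
    ∫ x : Fin m → ℝ, |x i| * x k ^ 2 ∂(Measure.pi fun _ : Fin m => gaussianReal 0 1)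
      ≤ 4 / 5 + if i = k then 4 / 5 else 0 := by
  obtain rfl | hik := eq_or_ne i k
  · have h : ∀ x : Fin m → ℝ, |x i| * x i ^ 2 = |x i| ^ 3 := fun x => by
      rw [← sq_abs (x i)]; ring
    simp_rw [h]
    refine ⟨integrable_comp_eval (μ := fun _ : Fin m => gaussianReal 0 1) (i := i)
      (integrable_abs_pow_gaussianReal 3), ?_⟩
    rw [integral_comp_eval (μ := fun _ : Fin m => gaussianReal 0 1) (i := i)
      (integrable_abs_pow_gaussianReal 3).aestronglyMeasurable]
    simp only [if_true]
    linarith [integral_abs_pow_three_gaussianReal_le]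
  · have hind : IndepFun (fun x : Fin m → ℝ => |x i|) (fun x : Fin m → ℝ => x k ^ 2)
        (Measure.pi fun _ : Fin m => gaussianReal 0 1) :=
      ((iIndepFun_pi (μ := fun _ : Fin m => gaussianReal 0 1) (X := fun _ x => x)
        (fun _ => aemeasurable_id)).indepFun hik).comp (φ := fun x => |x|) (ψ := fun x => x ^ 2)
        (by fun_prop) (by fun_prop)
    have i1 : Integrable (fun x : Fin m → ℝ => |x i|)
        (Measure.pi fun _ : Fin m => gaussianReal 0 1) :=
      integrable_comp_eval (μ := fun _ : Fin m => gaussianReal 0 1) (i := i) (f := fun x => |x|)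
        (by simpa using integrable_abs_pow_gaussianReal 1)
    have q := integral_sq_gaussianReal 0 0 1
    simp only [sub_zero] at q
    have i2 : Integrable (fun x : Fin m → ℝ => x k ^ 2)
        (Measure.pi fun _ : Fin m => gaussianReal 0 1) :=
      integrable_comp_eval (μ := fun _ : Fin m => gaussianReal 0 1) (i := k) q.1
    refine ⟨hind.integrable_mul i1 i2, ?_⟩
    have e := hind.integral_mul_eq_mul_integral i1.aestronglyMeasurable i2.aestronglyMeasurable
    simp only [Pi.mul_apply] at e
    rw [e, integral_comp_eval (μ := fun _ : Fin m => gaussianReal 0 1) (i := k)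
        q.1.aestronglyMeasurable, q.2,
      integral_comp_eval (μ := fun _ : Fin m => gaussianReal 0 1) (i := i) (f := fun x => |x|)
        (by fun_prop)]
    simpa [hik] using integral_abs_gaussianReal_le

theorem cube_sum_abs_le {m : ℕ} (x : Fin m → ℝ) :
    (∑ i, |x i|) ^ 3 ≤ m * ∑ i, ∑ k, |x i| * x k ^ 2 := by
  have h := sq_sum_le_card_mul_sum_sq (s := Finset.univ) (f := fun i => |x i|)
  simp only [sq_abs, Finset.card_univ, Fintype.card_fin] at h
  have h0 : 0 ≤ ∑ i, |x i| := Finset.sum_nonneg fun i _ => abs_nonneg _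
  rw [← Finset.sum_mul_sum]
  nlinarith [mul_le_mul_of_nonneg_left h h0]

/-- Third moment of the `ℓ¹` norm of a standard Gaussian vector. The constant `4 / 5` is an upper
bound for `E|g| = √(2 / π)`, and `8 / 5` for `E|g|³ = 2 E|g|`. -/
theorem integral_cube_sum_abs_le (m : ℕ) :
    Integrable (fun x : Fin m → ℝ => (∑ i, |x i|) ^ 3)
      (Measure.pi fun _ : Fin m => gaussianReal 0 1) ∧
    ∫ x : Fin m → ℝ, (∑ i, |x i|) ^ 3 ∂(Measure.pi fun _ : Fin m => gaussianReal 0 1)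
      ≤ 4 / 5 * ((m : ℝ) ^ 3 + m ^ 2) := by
  have hI : Integrable (fun x : Fin m → ℝ => (m : ℝ) * ∑ i, ∑ k, |x i| * x k ^ 2)
      (Measure.pi fun _ : Fin m => gaussianReal 0 1) :=
    (integrable_finsetSum _ fun i _ => integrable_finsetSum _ fun k _ =>
      (integral_abs_mul_sq_pi_gaussian i k).1).const_mul _
  have hS : Integrable (fun x : Fin m → ℝ => (∑ i, |x i|) ^ 3)
      (Measure.pi fun _ : Fin m => gaussianReal 0 1) := by
    have hc : Continuous fun x : Fin m → ℝ => (∑ i, |x i|) ^ 3 := by fun_prop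
    refine hI.mono' hc.aestronglyMeasurable (ae_of_all _ fun x => ?_)
    rw [Real.norm_eq_abs, abs_of_nonneg
      (pow_nonneg (Finset.sum_nonneg fun i _ => abs_nonneg _) 3)]
    exact cube_sum_abs_le x
  refine ⟨hS, (integral_mono hS hI cube_sum_abs_le).trans ?_⟩
  rw [integral_const_mul, integral_finsetSum _ fun i _ => integrable_finsetSum _ fun k _ =>
    (integral_abs_mul_sq_pi_gaussian i k).1]
  simp_rw [integral_finsetSum _ fun k _ => (integral_abs_mul_sq_pi_gaussian _ k).1]
  have : ∑ i : Fin m, ∑ k : Fin m,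
      ∫ x : Fin m → ℝ, |x i| * x k ^ 2 ∂(Measure.pi fun _ : Fin m => gaussianReal 0 1)
      ≤ ∑ i : Fin m, ∑ k : Fin m, ((4 / 5 : ℝ) + if i = k then 4 / 5 else 0) :=
    Finset.sum_le_sum fun i _ => Finset.sum_le_sum fun k _ =>
      (integral_abs_mul_sq_pi_gaussian i k).2
  calc _ ≤ (m : ℝ) * ∑ i : Fin m, ∑ k : Fin m, ((4 / 5 : ℝ) + if i = k then 4 / 5 else 0) :=
        mul_le_mul_of_nonneg_left this (by positivity)
    _ = _ := by
        simp [Finset.sum_add_distrib]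
        ring

theorem integral_eval_mul_eval_pi_gaussian {m : ℕ} (i k : Fin m) :
    Integrable (fun x : Fin m → ℝ => x i * x k)
      (Measure.pi fun _ : Fin m => gaussianReal 0 1) ∧
    ∫ x : Fin m → ℝ, x i * x k ∂(Measure.pi fun _ : Fin m => gaussianReal 0 1)
      = if i = k then 1 else 0 := by
  have q := integral_sq_gaussianReal 0 0 1
  simp only [sub_zero] at q
  have hid : Integrable (fun x : ℝ => x) (gaussianReal 0 1) :=
    (memLp_id_gaussianReal (μ := 0) (v := 1) 1).integrable (by simp)
  obtain rfl | hik := eq_or_ne i k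
  · simp_rw [← sq]
    refine ⟨integrable_comp_eval (μ := fun _ : Fin m => gaussianReal 0 1) (i := i) q.1, ?_⟩
    rw [integral_comp_eval (μ := fun _ : Fin m => gaussianReal 0 1) (i := i)
        q.1.aestronglyMeasurable, q.2]
    simp
  · have hind : IndepFun (fun x : Fin m → ℝ => x i) (fun x : Fin m → ℝ => x k)
        (Measure.pi fun _ : Fin m => gaussianReal 0 1) :=
      (iIndepFun_pi (μ := fun _ : Fin m => gaussianReal 0 1) (X := fun _ x => x)
        (fun _ => aemeasurable_id)).indepFun hik
    have i1 : ∀ j, Integrable (fun x : Fin m → ℝ => x j)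
        (Measure.pi fun _ : Fin m => gaussianReal 0 1) := fun j =>
      integrable_comp_eval (μ := fun _ : Fin m => gaussianReal 0 1) (i := j) hid
    refine ⟨hind.integrable_mul (i1 i) (i1 k), ?_⟩
    have e := hind.integral_mul_eq_mul_integral (i1 i).aestronglyMeasurable
      (i1 k).aestronglyMeasurable
    simp only [Pi.mul_apply] at e
    rw [e, integral_comp_eval (μ := fun _ : Fin m => gaussianReal 0 1) (i := i)
      hid.aestronglyMeasurable, integral_id_gaussianReal]
    simp [hik]

theorem integral_eval_pi_gaussian {m : ℕ} (i : Fin m) :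
    Integrable (fun x : Fin m → ℝ => x i) (Measure.pi fun _ : Fin m => gaussianReal 0 1) ∧
    ∫ x : Fin m → ℝ, x i ∂(Measure.pi fun _ : Fin m => gaussianReal 0 1) = 0 := by
  have hid : Integrable (fun x : ℝ => x) (gaussianReal 0 1) :=
    (memLp_id_gaussianReal (μ := 0) (v := 1) 1).integrable (by simp)
  refine ⟨integrable_comp_eval (μ := fun _ : Fin m => gaussianReal 0 1) (i := i) hid, ?_⟩
  rw [integral_comp_eval (μ := fun _ : Fin m => gaussianReal 0 1) (i := i)
    hid.aestronglyMeasurable, integral_id_gaussianReal]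

/-! ### PAC-Bayes bounds -/

/-- Generalization gap of the hypothesis `w`: population loss minus empirical loss on `S`. -/
def gap {Z W : Type*} [MeasurableSpace Z] {n : ℕ} (D : Measure Z) (ℓ : Z → W → ℝ)
    (S : Fin n → Z) (w : W) : ℝ :=
  ∫ z, ℓ z w ∂D - (1 / (n : ℝ)) * ∑ i, ℓ (S i) w

section PACBayes

variable {Z W : Type*} [MeasurableSpace Z] [MeasurableSpace W] {n : ℕ} {D : Measure Z}
  [IsProbabilityMeasure D] {ℓ : Z → W → ℝ} {L : ℝ}

theorem measurable_gap (hℓ : Measurable (Function.uncurry ℓ)) :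
    Measurable fun q : (Fin n → Z) × W => gap D ℓ q.1 q.2 := by
  have h1 : Measurable fun w => ∫ z, ℓ z w ∂D :=
    (hℓ.stronglyMeasurable.integral_prod_left (μ := D)).measurable
  have h2 : ∀ i, Measurable fun q : (Fin n → Z) × W => ℓ (q.1 i) q.2 := fun i =>
    hℓ.comp (f := fun q : (Fin n → Z) × W => (q.1 i, q.2))
      (((measurable_pi_apply i).comp measurable_fst).prodMk measurable_snd)
  unfold gap
  exact (h1.comp measurable_snd).sub
    ((Finset.measurable_sum _ fun i _ => h2 i).const_mul _)

theorem abs_gap_le (hn : 0 < n) (hℓ : Measurable (Function.uncurry ℓ))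
    (h0 : ∀ z w, ℓ z w ∈ Set.Icc 0 L) (S : Fin n → Z) (w : W) : |gap D ℓ S w| ≤ L := by
  have hn' : (0 : ℝ) < n := by exact_mod_cast hn
  have hm : Measurable fun z => ℓ z w := hℓ.comp (measurable_id.prodMk measurable_const)
  have hi : Integrable (fun z => ℓ z w) D :=
    Integrable.of_mem_Icc 0 L hm.aemeasurable (ae_of_all _ fun z => h0 z w)
  have a1 : 0 ≤ ∫ z, ℓ z w ∂D := integral_nonneg fun z => (h0 z w).1
  have a2 : ∫ z, ℓ z w ∂D ≤ L := by
    simpa using integral_mono hi (integrable_const L) fun z => (h0 z w).2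
  have a3 : 0 ≤ (1 / (n : ℝ)) * ∑ i, ℓ (S i) w :=
    mul_nonneg (by positivity) (Finset.sum_nonneg fun i _ => (h0 _ _).1)
  have a4 : (1 / (n : ℝ)) * ∑ i, ℓ (S i) w ≤ L := by
    have : ∑ i, ℓ (S i) w ≤ ∑ _i : Fin n, L := Finset.sum_le_sum fun i _ => (h0 _ _).2
    simp only [Finset.sum_const, Finset.card_univ, Fintype.card_fin, nsmul_eq_mul] at this
    rw [one_div, inv_mul_le_iff₀ hn']
    exact this
  rw [gap, abs_le]
  constructor <;> linarith

/-- Hoeffding's lemma for the generalization gap at a fixed `w`: the gap is a sum of `n`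
independent centred terms, each ranging over an interval of length `L / n`. -/
theorem integral_exp_gap_le (hn : 0 < n) (hℓ : Measurable (Function.uncurry ℓ))
    (h0 : ∀ z w, ℓ z w ∈ Set.Icc 0 L) (t : ℝ) (w : W) :
    ∫ S, Real.exp (t * gap D ℓ S w) ∂(Measure.pi fun _ : Fin n => D)
      ≤ Real.exp (t ^ 2 * L ^ 2 / (8 * n)) := by
  have hn' : (n : ℝ) ≠ 0 := by exact_mod_cast hn.ne'
  have hm : Measurable fun z => ℓ z w := hℓ.comp (measurable_id.prodMk measurable_const)
  have hsub := (hasSubgaussianMGF_of_mem_Icc (μ := D) hm.aemeasurable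
    (ae_of_all _ fun z => h0 z w)).mgf_le (-t / n)
  have hfac : ∀ S : Fin n → Z, Real.exp (t * gap D ℓ S w) =
      ∏ i, Real.exp (-t / n * (ℓ (S i) w - ∫ z, ℓ z w ∂D)) := by
    intro S
    rw [← Real.exp_sum, ← Finset.mul_sum, Finset.sum_sub_distrib, gap]
    simp only [Finset.sum_const, Finset.card_univ, Fintype.card_fin, nsmul_eq_mul]
    congr 1
    field_simp
    ring
  simp_rw [hfac]
  rw [integral_fintype_prod_eq_pow
    (fun z => Real.exp (-t / n * (ℓ z w - ∫ z, ℓ z w ∂D))), Fintype.card_fin]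
  refine (pow_le_pow_left₀ (integral_nonneg fun z => (Real.exp_pos _).le) hsub n).trans ?_
  rw [← Real.exp_nat_mul]
  refine Real.exp_le_exp.2 (le_of_eq ?_)
  simp
  field_simp
  rw [sq_abs]
  ring

theorem integral_integral_exp_gap_le (hn : 0 < n) (hℓ : Measurable (Function.uncurry ℓ))
    (h0 : ∀ z w, ℓ z w ∈ Set.Icc 0 L) (t : ℝ) (P : Measure W) [IsProbabilityMeasure P] :
    ∫ S, ∫ w, Real.exp (t * gap D ℓ S w) ∂P ∂(Measure.pi fun _ : Fin n => D)
      ≤ Real.exp (t ^ 2 * L ^ 2 / (8 * n)) := by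
  have hmeas : Measurable fun q : (Fin n → Z) × W => Real.exp (t * gap D ℓ q.1 q.2) :=
    ((measurable_gap hℓ).const_mul t).exp
  have hint : Integrable (fun q : (Fin n → Z) × W => Real.exp (t * gap D ℓ q.1 q.2))
      ((Measure.pi fun _ : Fin n => D).prod P) := by
    refine Integrable.of_bound hmeas.aestronglyMeasurable (Real.exp (|t| * L))
      (ae_of_all _ fun q => ?_)
    rw [Real.norm_eq_abs, Real.abs_exp]
    refine Real.exp_le_exp.2 ((le_abs_self _).trans ?_)
    rw [abs_mul]
    exact mul_le_mul_of_nonneg_left (abs_gap_le hn hℓ h0 _ _) (abs_nonneg t)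
  rw [integral_integral_swap hint]
  have := integral_mono hint.integral_prod_right (integrable_const _)
    fun w => integral_exp_gap_le hn hℓ h0 t w
  simpa using this

/-- Markov's inequality and a union bound over finitely many priors `P j`, each with its own
temperature `t j`. -/
theorem exists_event_log_integral_exp_gap_le (hn : 0 < n)
    (hℓ : Measurable (Function.uncurry ℓ)) (h0 : ∀ z w, ℓ z w ∈ Set.Icc 0 L) {N : ℕ}
    (hN : 0 < N) (P : Fin N → Measure W) [∀ j, IsProbabilityMeasure (P j)] (t : Fin N → ℝ)
    {ξ : ℝ} (hξ : 0 < ξ) :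
    ∃ E : Set (Fin n → Z), MeasurableSet E ∧
      ENNReal.ofReal (1 - ξ) ≤ Measure.pi (fun _ : Fin n => D) E ∧
      ∀ S ∈ E, ∀ j, Real.log (∫ w, Real.exp (t j * gap D ℓ S w) ∂(P j))
        ≤ t j ^ 2 * L ^ 2 / (8 * n) + Real.log (N / ξ) := by
  have hN' : (0 : ℝ) < N := by exact_mod_cast hN
  set μ := Measure.pi (fun _ : Fin n => D) with hμ
  have hmeas : ∀ j, Measurable fun q : (Fin n → Z) × W => Real.exp (t j * gap D ℓ q.1 q.2) :=
    fun j => ((measurable_gap hℓ).const_mul (t j)).exp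
  have hmeasS : ∀ j, Measurable fun S : Fin n → Z =>
      ∫ w, Real.exp (t j * gap D ℓ S w) ∂(P j) := fun j =>
    ((hmeas j).stronglyMeasurable.integral_prod_right (ν := P j)).measurable
  have hbd : ∀ j S w, Real.exp (t j * gap D ℓ S w) ≤ Real.exp (|t j| * L) := fun j S w => by
    refine Real.exp_le_exp.2 ((le_abs_self _).trans ?_)
    rw [abs_mul]
    exact mul_le_mul_of_nonneg_left (abs_gap_le hn hℓ h0 _ _) (abs_nonneg _)
  have hintW : ∀ j (S : Fin n → Z), Integrable (fun w => Real.exp (t j * gap D ℓ S w)) (P j) :=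
    fun j S => Integrable.of_bound
      ((hmeas j).comp (measurable_const.prodMk measurable_id)).aestronglyMeasurable
      (Real.exp (|t j| * L)) (ae_of_all _ fun w => by
        rw [Real.norm_eq_abs, Real.abs_exp]; exact hbd j S w)
  have hintS : ∀ j, Integrable (fun S => ∫ w, Real.exp (t j * gap D ℓ S w) ∂(P j)) μ :=
    fun j => Integrable.of_bound (hmeasS j).aestronglyMeasurable (Real.exp (|t j| * L))
      (ae_of_all _ fun S => by
        rw [Real.norm_eq_abs, abs_of_nonneg (integral_nonneg fun w => (Real.exp_pos _).le)]
        simpa using integral_mono (hintW j S) (integrable_const _) fun w => hbd j S w)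
  set c : Fin N → ℝ := fun j => Real.exp (t j ^ 2 * L ^ 2 / (8 * n)) * (N / ξ) with hc
  set B : Fin N → Set (Fin n → Z) := fun j =>
    {S | c j ≤ ∫ w, Real.exp (t j * gap D ℓ S w) ∂(P j)} with hB
  have hBm : ∀ j, MeasurableSet (B j) := fun j => measurableSet_le measurable_const (hmeasS j)
  have hBle : ∀ j, μ.real (B j) ≤ ξ / N := fun j => by
    have h1 := mul_meas_ge_le_integral_of_nonneg
      (ae_of_all μ fun S => integral_nonneg fun w => (Real.exp_pos (t j * gap D ℓ S w)).le)
      (hintS j) (c j)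
    have h2 := h1.trans (integral_integral_exp_gap_le hn hℓ h0 (t j) (P j))
    have h3 : (N / ξ) * μ.real (B j) ≤ 1 := by
      have : Real.exp (t j ^ 2 * L ^ 2 / (8 * n)) * ((N / ξ) * μ.real (B j))
          ≤ Real.exp (t j ^ 2 * L ^ 2 / (8 * n)) * 1 := by
        rw [mul_one, ← mul_assoc]; exact h2
      exact le_of_mul_le_mul_left this (Real.exp_pos _)
    rw [le_div_iff₀ hN']
    rw [div_mul_eq_mul_div, div_le_one hξ] at h3
    linarith
  have hU : μ.real (⋃ j, B j) ≤ ξ := by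
    refine (measureReal_iUnion_fintype_le B).trans ((Finset.sum_le_sum fun j _ => hBle j).trans ?_)
    simp
    field_simp
    rfl
  refine ⟨(⋃ j, B j)ᶜ, (MeasurableSet.iUnion hBm).compl, ?_, fun S hS j => ?_⟩
  · rw [← ofReal_measureReal, probReal_compl_eq_one_sub (MeasurableSet.iUnion hBm)]
    exact ENNReal.ofReal_le_ofReal (by linarith)
  · have hS' : ∫ w, Real.exp (t j * gap D ℓ S w) ∂(P j) < c j := by
      by_contra hcon
      exact hS (Set.mem_iUnion.2 ⟨j, not_lt.1 hcon⟩)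
    have hpos : 0 < ∫ w, Real.exp (t j * gap D ℓ S w) ∂(P j) :=
      integral_exp_pos (hintW j S)
    refine (Real.log_le_log hpos hS'.le).trans (le_of_eq ?_)
    rw [hc, Real.log_mul (Real.exp_ne_zero _) (by positivity), Real.log_exp]

end PACBayes

/-- Uniform PAC-Bayes bound for isotropic Gaussian posteriors `N(θ, s² I)` of fixed width. The
prior `N(0, s² exp(j / m) I)`, `j < N`, is chosen according to the size of `θ`: for
`j = ⌈m log (1 + ‖θ‖² / (m s²))⌉` its divergence from the posterior is at most `j / 2`, a bound
that does not depend on `θ`, so that the temperature may be optimized for each `j` beforehand. -/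
theorem exists_event_integral_gap_le {Z : Type*} [MeasurableSpace Z] {n m : ℕ} {D : Measure Z}
    [IsProbabilityMeasure D] {ℓ : Z → (Fin m → ℝ) → ℝ} {L : ℝ} (hn : 0 < n) (hm : 0 < m)
    (hL : 0 < L) (hℓ : Measurable (Function.uncurry ℓ)) (h0 : ∀ z w, ℓ z w ∈ Set.Icc 0 L)
    {N : ℕ} (hN : 0 < N) {s : ℝ≥0} (hs : s ≠ 0) {ξ : ℝ} (hξ : 0 < ξ) (hξ1 : ξ < 1) :
    ∃ E : Set (Fin n → Z), MeasurableSet E ∧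
      ENNReal.ofReal (1 - ξ) ≤ Measure.pi (fun _ : Fin n => D) E ∧
      ∀ S ∈ E, ∀ a : Fin m → ℝ,
        m * Real.log (1 + (∑ i, a i ^ 2) / (m * s ^ 2)) ≤ (N : ℝ) - 1 →
        ∫ x, gap D ℓ S x ∂(Measure.pi fun i => gaussianReal (a i) (s ^ 2)) ≤
          L / (2 * Real.sqrt n) * Real.sqrt
            (m * Real.log (1 + (∑ i, a i ^ 2) / (m * s ^ 2)) + 1 + 2 * Real.log (1 / ξ)
              + 2 * Real.log N) := by
  have hn' : (0 : ℝ) < n := by exact_mod_cast hn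
  have hm' : (0 : ℝ) < m := by exact_mod_cast hm
  have hN' : (1 : ℝ) ≤ N := by exact_mod_cast hN
  have hs' : (0 : ℝ) < s := by positivity
  have hlogξ : 0 < Real.log (1 / ξ) := Real.log_pos (by rw [lt_div_iff₀ hξ]; linarith)
  have hlogN : 0 ≤ Real.log N := Real.log_nonneg hN'
  have hlog : Real.log (N / ξ) = Real.log N + Real.log (1 / ξ) := by
    rw [← Real.log_mul (by positivity) (by positivity), mul_one_div]
  set τ : Fin N → ℝ≥0 := fun j => s ^ 2 * (Real.exp (j / m)).toNNReal with hτ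
  set A : Fin N → ℝ := fun j => Real.log (N / ξ) + (j : ℝ) / 2 with hA
  have hApos : ∀ j, 0 < A j := fun j => by simp only [hA, hlog]; positivity
  -- the minimizer of `t L² / (8 n) + A j / t`
  set t : Fin N → ℝ := fun j => Real.sqrt (8 * n * A j) / L with ht
  have htpos : ∀ j, 0 < t j := fun j => by
    have := hApos j
    simp only [ht]; positivity
  obtain ⟨E, hE, hPE, hbound⟩ := exists_event_log_integral_exp_gap_le (D := D) hn hℓ h0 hN
    (fun j => Measure.pi fun _ : Fin m => gaussianReal 0 (τ j)) t hξ
  refine ⟨E, hE, hPE, fun S hS a ha => ?_⟩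
  set T : ℝ := m * Real.log (1 + (∑ i, a i ^ 2) / (m * s ^ 2)) with hT
  have hsum : 0 ≤ ∑ i, a i ^ 2 := Finset.sum_nonneg fun i _ => sq_nonneg _
  have harg : 1 ≤ 1 + (∑ i, a i ^ 2) / (m * (s : ℝ) ^ 2) := by
    have : 0 ≤ (∑ i, a i ^ 2) / (m * (s : ℝ) ^ 2) := by positivity
    linarith
  have hT0 : 0 ≤ T := mul_nonneg hm'.le (Real.log_nonneg harg)
  have hjlt : ⌈T⌉₊ < N := by
    have : (⌈T⌉₊ : ℝ) < N := (Nat.ceil_lt_add_one hT0).trans_le (by linarith)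
    exact_mod_cast this
  set j : Fin N := ⟨⌈T⌉₊, hjlt⟩ with hj
  have hjT : T ≤ (j : ℝ) := Nat.le_ceil T
  have hjT1 : (j : ℝ) < T + 1 := Nat.ceil_lt_add_one hT0
  have hτj : τ j ≠ 0 := by
    simp only [hτ]
    exact mul_ne_zero (pow_ne_zero 2 hs) (by simp [Real.exp_pos])
  have hτv : (τ j : ℝ) = (s : ℝ) ^ 2 * Real.exp (j / m) := by
    simp [hτ, Real.coe_toNNReal _ (Real.exp_pos _).le]
  have hgm : Measurable fun x => t j * gap D ℓ S x :=
    ((measurable_gap hℓ).comp (measurable_const.prodMk measurable_id)).const_mul _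
  have hDV := integral_pi_gaussian_le_log_integral_exp_add a (pow_ne_zero 2 hs) hτj
    (fun x => t j * gap D ℓ S x) hgm (t j * L) (fun x => by
      rw [abs_mul, abs_of_pos (htpos j)]
      exact mul_le_mul_of_nonneg_left (abs_gap_le hn hℓ h0 S x) (htpos j).le)
  have hKL : (m * (Real.log (τ j / (s ^ 2 : ℝ≥0)) / 2 - 1 / 2)
      + (m * ((s ^ 2 : ℝ≥0) : ℝ) + ∑ i, a i ^ 2) / (2 * τ j)) ≤ (j : ℝ) / 2 := by
    have e1 : Real.log (τ j / (s ^ 2 : ℝ≥0)) = j / m := by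
      rw [hτv]; push_cast
      rw [mul_div_cancel_left₀ _ (by positivity), Real.log_exp]
    have e2 : 1 + (∑ i, a i ^ 2) / (m * (s : ℝ) ^ 2) ≤ Real.exp (j / m) := by
      rw [← Real.log_le_iff_le_exp (by linarith), le_div_iff₀ hm', mul_comm]
      exact hjT
    have e3 : (m * ((s ^ 2 : ℝ≥0) : ℝ) + ∑ i, a i ^ 2) / (2 * τ j) ≤ m / 2 := by
      have e4 : m * ((s ^ 2 : ℝ≥0) : ℝ) + ∑ i, a i ^ 2
          = m * (s : ℝ) ^ 2 * (1 + (∑ i, a i ^ 2) / (m * (s : ℝ) ^ 2)) := by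
        push_cast; field_simp
      rw [e4, hτv, div_le_iff₀ (by positivity)]
      calc _ ≤ m * (s : ℝ) ^ 2 * Real.exp (j / m) :=
            mul_le_mul_of_nonneg_left e2 (by positivity)
        _ = _ := by ring
    rw [e1]
    have : (m : ℝ) * (j / m / 2 - 1 / 2) = (j : ℝ) / 2 - m / 2 := by field_simp
    linarith
  have hb := hbound S hS j
  rw [integral_const_mul] at hDV
  set I := ∫ x, gap D ℓ S x ∂(Measure.pi fun i => gaussianReal (a i) (s ^ 2)) with hI
  have hmain : t j * I ≤ t j ^ 2 * L ^ 2 / (8 * n) + A j := by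
    simp only [hA]; linarith
  have hIle : I ≤ L / (2 * Real.sqrt n) * Real.sqrt (2 * A j) := by
    have hsq : Real.sqrt (8 * n * A j) = 2 * Real.sqrt n * Real.sqrt (2 * A j) := by
      rw [show 8 * n * A j = 2 ^ 2 * n * (2 * A j) by ring,
        Real.sqrt_mul (by positivity), Real.sqrt_mul (by positivity),
        Real.sqrt_sq (by norm_num)]
    have h2A : Real.sqrt (2 * A j) ^ 2 = 2 * A j := Real.sq_sqrt (by linarith [hApos j])
    have hsn : Real.sqrt n ^ 2 = n := Real.sq_sqrt hn'.le
    have hsnp := Real.sqrt_pos.2 hn'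
    have hsA : 0 < Real.sqrt (2 * A j) := Real.sqrt_pos.2 (by linarith [hApos j])
    refine le_of_mul_le_mul_left (hmain.trans (le_of_eq ?_)) (htpos j)
    have htj : t j = 2 * Real.sqrt n * Real.sqrt (2 * A j) / L := by
      simp only [ht]; rw [hsq]
    have hAj : A j = Real.sqrt (2 * A j) ^ 2 / 2 := by linarith
    have e1 : t j ^ 2 * L ^ 2 / (8 * n) = A j := by
      rw [htj, div_pow, mul_pow, mul_pow, hsn, h2A]
      field_simp
      ring
    have e2 : t j * (L / (2 * Real.sqrt n) * Real.sqrt (2 * A j)) = Real.sqrt (2 * A j) ^ 2 := by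
      rw [htj]; field_simp
    rw [e1, e2, h2A]; ring
  refine hIle.trans (mul_le_mul_of_nonneg_left (Real.sqrt_le_sqrt ?_) (by positivity))
  simp only [hA, hlog]
  linarith

/-! ### Taylor expansion under Gaussian perturbations -/

section Taylor

variable {E : Type*} [NormedAddCommGroup E] [NormedSpace ℝ E]

theorem hasDerivAt_iteratedFDeriv_line {f : E → ℝ} {k : ℕ} {x v : E} {t : ℝ}
    (h : DifferentiableAt ℝ (iteratedFDeriv ℝ k f) (x + t • v)) :
    HasDerivAt (fun t : ℝ => iteratedFDeriv ℝ k f (x + t • v) fun _ => v)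
      (iteratedFDeriv ℝ (k + 1) f (x + t • v) fun _ => v) t := by
  have hline : HasDerivAt (fun t : ℝ => x + t • v) v t := by
    simpa using ((hasDerivAt_id t).smul_const v).const_add x
  have h1 := h.hasFDerivAt.comp_hasDerivAt t hline
  have h2 := (ContinuousMultilinearMap.apply ℝ (fun _ : Fin k => E) ℝ
    (fun _ => v)).hasFDerivAt.comp_hasDerivAt t h1
  rw [iteratedFDeriv_succ_apply_left]
  exact h2

theorem nonpos_of_hasDerivAt_nonpos {g g' : ℝ → ℝ} (h : ∀ t, HasDerivAt g (g' t) t)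
    (h0 : g 0 = 0) (hg' : ∀ t, 0 ≤ t → g' t ≤ 0) {t : ℝ} (ht : 0 ≤ t) : g t ≤ 0 := by
  have : AntitoneOn g (Set.Ici 0) := by
    refine antitoneOn_of_deriv_nonpos (convex_Ici 0)
      (fun s _ => (h s).continuousAt.continuousWithinAt)
      (fun s _ => (h s).differentiableAt.differentiableWithinAt) fun s hs => ?_
    rw [interior_Ici] at hs
    rw [(h s).deriv]
    exact hg' s (le_of_lt hs)
  rw [← h0]
  exact this Set.self_mem_Ici ht ht

/-- Taylor's inequality of order two on `[0, 1]`. The third derivative is only assumed to exist and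
to be bounded above, not to be continuous or integrable. -/
theorem le_taylor_two_add {φ φ₁ φ₂ φ₃ : ℝ → ℝ} {M : ℝ} (h0 : ∀ t, HasDerivAt φ (φ₁ t) t)
    (h1 : ∀ t, HasDerivAt φ₁ (φ₂ t) t) (h2 : ∀ t, HasDerivAt φ₂ (φ₃ t) t)
    (hM : ∀ t, φ₃ t ≤ M) : φ 1 ≤ φ 0 + φ₁ 0 + φ₂ 0 / 2 + M / 6 := by
  have k2 : ∀ t, 0 ≤ t → φ₂ t - φ₂ 0 - M * t ≤ 0 := fun t ht =>
    nonpos_of_hasDerivAt_nonpos (g' := fun t => φ₃ t - M * 1)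
      (fun t => ((h2 t).sub_const _).sub ((hasDerivAt_id t).const_mul M)) (by simp)
      (fun t _ => by linarith [hM t]) ht
  have k1 : ∀ t, 0 ≤ t → φ₁ t - φ₁ 0 - φ₂ 0 * t - M / 2 * t ^ 2 ≤ 0 := fun t ht =>
    nonpos_of_hasDerivAt_nonpos (g' := fun t => φ₂ t - φ₂ 0 * 1 - M / 2 * (2 * t ^ 1))
      (fun t => (((h1 t).sub_const _).sub ((hasDerivAt_id t).const_mul _)).sub
        (((hasDerivAt_pow 2 t)).const_mul _)) (by simp)
      (fun t ht => by have := k2 t ht; simp only [pow_one]; linarith) ht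
  have k0 := nonpos_of_hasDerivAt_nonpos
      (g := fun t => φ t - φ 0 - φ₁ 0 * t - φ₂ 0 / 2 * t ^ 2 - M / 6 * t ^ 3)
      (g' := fun t => φ₁ t - φ₁ 0 * 1 - φ₂ 0 / 2 * (2 * t ^ 1) - M / 6 * (3 * t ^ 2))
      (fun t => ((((h0 t).sub_const _).sub ((hasDerivAt_id t).const_mul _)).sub
        (((hasDerivAt_pow 2 t)).const_mul _)).sub (((hasDerivAt_pow 3 t)).const_mul _)) (by simp)
      (fun t ht => by have := k1 t ht; simp only [pow_one]; linarith) zero_le_one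
  simp only [one_pow, mul_one] at k0
  linarith

end Taylor

section Euclidean

variable {m : ℕ}

theorem sum_smul_stdBasis (v : EuclideanSpace ℝ (Fin m)) : ∑ i, v i • stdBasis i = v := by
  ext j
  simp [Finset.sum_apply, Pi.single_apply]

theorem abs_iteratedFDeriv_three_le {f : EuclideanSpace ℝ (Fin m) → ℝ} {C : ℝ}
    {x : EuclideanSpace ℝ (Fin m)} (hC : ∀ i j k, |thirdPartial f x i j k| ≤ C)
    (v : EuclideanSpace ℝ (Fin m)) :
    |iteratedFDeriv ℝ 3 f x fun _ => v| ≤ C * (∑ i, |v i|) ^ 3 := by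
  have h1 : (iteratedFDeriv ℝ 3 f x fun _ => v) =
      ∑ r : Fin 3 → Fin m, (∏ i, v (r i)) * iteratedFDeriv ℝ 3 f x fun i => stdBasis (r i) := by
    conv_lhs => rw [← sum_smul_stdBasis v]
    rw [ContinuousMultilinearMap.map_sum]
    refine Finset.sum_congr rfl fun r _ => ?_
    rw [ContinuousMultilinearMap.map_smul_univ, smul_eq_mul]
  have h2 : ∀ r : Fin 3 → Fin m, |iteratedFDeriv ℝ 3 f x fun i => stdBasis (r i)| ≤ C := by
    intro r
    have : (fun i => stdBasis (r i)) = ![stdBasis (r 0), stdBasis (r 1), stdBasis (r 2)] := by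
      funext i; fin_cases i <;> rfl
    rw [this]
    exact hC _ _ _
  rw [h1, Fintype.sum_pow, Finset.mul_sum]
  refine (Finset.abs_sum_le_sum_abs _ _).trans (Finset.sum_le_sum fun r _ => ?_)
  rw [abs_mul, Finset.abs_prod, mul_comm]
  exact mul_le_mul_of_nonneg_right (h2 r) (Finset.prod_nonneg fun _ _ => abs_nonneg _)

theorem abs_sub_taylor_two_le {f : EuclideanSpace ℝ (Fin m) → ℝ} {C : ℝ}
    (hf : ContDiff ℝ 2 f) (hf3 : Differentiable ℝ (iteratedFDeriv ℝ 2 f))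
    (hC : ∀ x i j k, |thirdPartial f x i j k| ≤ C) (x v : EuclideanSpace ℝ (Fin m)) :
    |f (x + v) - f x - fderiv ℝ f x v - (iteratedFDeriv ℝ 2 f x fun _ => v) / 2|
      ≤ C * (∑ i, |v i|) ^ 3 / 6 := by
  set φ : ℕ → ℝ → ℝ := fun k t => iteratedFDeriv ℝ k f (x + t • v) fun _ => v with hφ
  have d0 : ∀ t, HasDerivAt (φ 0) (φ 1 t) t := fun t =>
    hasDerivAt_iteratedFDeriv_line
      ((hf.differentiable_iteratedFDeriv (m := 0) (by norm_num)) _)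
  have d1 : ∀ t, HasDerivAt (φ 1) (φ 2 t) t := fun t =>
    hasDerivAt_iteratedFDeriv_line
      ((hf.differentiable_iteratedFDeriv (m := 1) (by norm_num)) _)
  have d2 : ∀ t, HasDerivAt (φ 2) (φ 3 t) t := fun t =>
    hasDerivAt_iteratedFDeriv_line (hf3 _)
  have hb : ∀ t, |φ 3 t| ≤ C * (∑ i, |v i|) ^ 3 := fun t => abs_iteratedFDeriv_three_le (hC _) v
  have up := le_taylor_two_add d0 d1 d2 fun t => (abs_le.1 (hb t)).2
  have lo := le_taylor_two_add (fun t => (d0 t).neg) (fun t => (d1 t).neg) (fun t => (d2 t).neg)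
    (M := C * (∑ i, |v i|) ^ 3) fun t => by
      linarith [(abs_le.1 (hb t)).1]
  simp only [hφ, Pi.neg_apply, one_smul, zero_smul, add_zero, iteratedFDeriv_zero_apply,
    iteratedFDeriv_one_apply] at up lo
  rw [abs_le]
  constructor <;> linarith

/-- Second-order expansion of a Gaussian average of `f` around `θ`. -/
theorem abs_integral_gaussian_sub_le {f : EuclideanSpace ℝ (Fin m) → ℝ} {C L : ℝ}
    (hf : ContDiff ℝ 2 f) (hf3 : Differentiable ℝ (iteratedFDeriv ℝ 2 f))
    (hC : ∀ x i j k, |thirdPartial f x i j k| ≤ C) (hC0 : 0 ≤ C) (hL : ∀ x, |f x| ≤ L)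
    (θ : EuclideanSpace ℝ (Fin m)) {s : ℝ} (hs : 0 ≤ s) :
    |∫ x, f (θ + s • WithLp.toLp 2 x) ∂(Measure.pi fun _ : Fin m => gaussianReal 0 1)
        - f θ - s ^ 2 / 2 * (hessian f θ).trace|
      ≤ C * s ^ 3 / 6 * (4 / 5 * ((m : ℝ) ^ 3 + m ^ 2)) := by
  set γ := Measure.pi fun _ : Fin m => gaussianReal 0 1 with hγ
  set v : (Fin m → ℝ) → EuclideanSpace ℝ (Fin m) := fun x => s • WithLp.toLp 2 x with hv
  have hvm : Continuous v := by fun_prop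
  have i0 : Integrable (fun x => f (θ + v x)) γ :=
    Integrable.of_bound (hf.continuous.comp (by fun_prop)).aestronglyMeasurable L
      (ae_of_all _ fun x => hL _)
  have e1 : ∀ x, fderiv ℝ f θ (v x) = ∑ i, x i * (s * fderiv ℝ f θ (stdBasis i)) := fun x => by
    conv_lhs => rw [← sum_smul_stdBasis (v x)]
    rw [map_sum]
    refine Finset.sum_congr rfl fun i _ => ?_
    simp [hv]
    ring
  have e2 : ∀ x, (iteratedFDeriv ℝ 2 f θ fun _ => v x) / 2 =
      ∑ i, ∑ k, x i * x k *
        (s ^ 2 / 2 * fderiv ℝ (fderiv ℝ f) θ (stdBasis i) (stdBasis k)) := fun x => by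
    rw [iteratedFDeriv_two_apply]
    conv_lhs => rw [← sum_smul_stdBasis (v x)]
    simp only [map_sum, sum_apply, Finset.sum_div]
    rw [Finset.sum_comm]
    refine Finset.sum_congr rfl fun i _ => Finset.sum_congr rfl fun k _ => ?_
    simp [hv]
    ring
  have i1 : Integrable (fun x => fderiv ℝ f θ (v x)) γ := by
    simp_rw [e1]
    exact integrable_finsetSum _ fun i _ => (integral_eval_pi_gaussian i).1.mul_const _
  have i2 : Integrable (fun x => (iteratedFDeriv ℝ 2 f θ fun _ => v x) / 2) γ := by
    simp_rw [e2]
    exact integrable_finsetSum _ fun i _ => integrable_finsetSum _ fun k _ =>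
      (integral_eval_mul_eval_pi_gaussian i k).1.mul_const _
  have I1 : ∫ x, fderiv ℝ f θ (v x) ∂γ = 0 := by
    simp_rw [e1]
    rw [integral_finsetSum _ fun i _ => (integral_eval_pi_gaussian i).1.mul_const _]
    exact Finset.sum_eq_zero fun i _ => by
      rw [integral_mul_const, (integral_eval_pi_gaussian i).2, zero_mul]
  have I2 : ∫ x, (iteratedFDeriv ℝ 2 f θ fun _ => v x) / 2 ∂γ
      = s ^ 2 / 2 * (hessian f θ).trace := by
    simp_rw [e2]
    rw [integral_finsetSum _ fun i _ => integrable_finsetSum _ fun k _ =>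
      (integral_eval_mul_eval_pi_gaussian i k).1.mul_const _]
    have : ∀ i, ∫ x, ∑ k, x i * x k *
        (s ^ 2 / 2 * fderiv ℝ (fderiv ℝ f) θ (stdBasis i) (stdBasis k)) ∂γ
        = s ^ 2 / 2 * fderiv ℝ (fderiv ℝ f) θ (stdBasis i) (stdBasis i) := fun i => by
      rw [integral_finsetSum _ fun k _ =>
        (integral_eval_mul_eval_pi_gaussian i k).1.mul_const _,
        Finset.sum_eq_single i]
      · rw [integral_mul_const, (integral_eval_mul_eval_pi_gaussian i i).2, if_pos rfl, one_mul]
      · intro k _ hk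
        rw [integral_mul_const, (integral_eval_mul_eval_pi_gaussian i k).2, if_neg hk.symm,
          zero_mul]
      · simp
    rw [Finset.sum_congr rfl fun i _ => this i]
    simp [Matrix.trace, hessian, iteratedFDeriv_two_apply, Finset.mul_sum]
  have hR : ∀ x, |f (θ + v x) - f θ - fderiv ℝ f θ (v x)
      - (iteratedFDeriv ℝ 2 f θ fun _ => v x) / 2| ≤ C * s ^ 3 / 6 * (∑ i, |x i|) ^ 3 := fun x => by
    refine (abs_sub_taylor_two_le hf hf3 hC θ (v x)).trans (le_of_eq ?_)
    have : ∑ i, |v x i| = s * ∑ i, |x i| := by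
      simp [hv, abs_mul, abs_of_nonneg hs, Finset.mul_sum]
    rw [this]; ring
  have hsplit : ∫ x, (f (θ + v x) - f θ - fderiv ℝ f θ (v x)
      - (iteratedFDeriv ℝ 2 f θ fun _ => v x) / 2) ∂γ
      = ∫ x, f (θ + v x) ∂γ - f θ - s ^ 2 / 2 * (hessian f θ).trace := by
    have i3 : Integrable (fun x => f (θ + v x) - f θ) γ := i0.sub (integrable_const _)
    have i4 : Integrable (fun x => f (θ + v x) - f θ - fderiv ℝ f θ (v x)) γ := i3.sub i1
    rw [integral_sub i4 i2, integral_sub i3 i1, integral_sub i0 (integrable_const _), I1, I2]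
    simp
  rw [← hsplit, ← Real.norm_eq_abs]
  refine (norm_integral_le_of_norm_le ((integral_cube_sum_abs_le m).1.const_mul _)
    (ae_of_all _ hR)).trans ?_
  rw [integral_const_mul]
  exact mul_le_mul_of_nonneg_left (integral_cube_sum_abs_le m).2 (by positivity)

end Euclidean

/-! ### The Hessian of the cross-entropy loss -/

section Softmax

variable {c : ℕ}

theorem sum_exp_pos (u : Fin c → ℝ) (y : Fin c) : 0 < ∑ j, Real.exp (u j) :=
  Finset.sum_pos (fun _ _ => Real.exp_pos _) ⟨y, Finset.mem_univ y⟩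

theorem softmax_nonneg (u : Fin c → ℝ) (k : Fin c) : 0 ≤ softmax u k :=
  div_nonneg (Real.exp_pos _).le (Finset.sum_nonneg fun _ _ => (Real.exp_pos _).le)

theorem sum_softmax (u : Fin c → ℝ) (y : Fin c) : ∑ k, softmax u k = 1 := by
  simp only [softmax]
  rw [← Finset.sum_div, div_self (sum_exp_pos u y).ne']

theorem neg_log_softmax (u : Fin c → ℝ) (y : Fin c) :
    -Real.log (softmax u y) = Real.log (∑ j, Real.exp (u j)) - u y := by
  rw [softmax, Real.log_div (Real.exp_ne_zero _) (sum_exp_pos u y).ne', Real.log_exp]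
  ring

theorem hasDerivAt_log_sum_exp {u : ℝ → Fin c → ℝ} {u' : Fin c → ℝ} {t : ℝ} (y : Fin c)
    (h : ∀ k, HasDerivAt (fun t => u t k) (u' k) t) :
    HasDerivAt (fun t => Real.log (∑ j, Real.exp (u t j))) (∑ k, softmax (u t) k * u' k) t := by
  have h1 : HasDerivAt (fun t => ∑ j, Real.exp (u t j)) (∑ j, Real.exp (u t j) * u' j) t :=
    HasDerivAt.fun_sum fun j _ => (h j).exp
  refine (h1.log (sum_exp_pos _ y).ne').congr_deriv ?_
  rw [Finset.sum_div]
  exact Finset.sum_congr rfl fun k _ => by rw [softmax]; ring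

theorem hasDerivAt_softmax {u : ℝ → Fin c → ℝ} {u' : Fin c → ℝ} {t : ℝ}
    (h : ∀ k, HasDerivAt (fun t => u t k) (u' k) t) (k : Fin c) :
    HasDerivAt (fun t => softmax (u t) k)
      (softmax (u t) k * (u' k - ∑ j, softmax (u t) j * u' j)) t := by
  have hs : ∀ t, softmax (u t) k = Real.exp (u t k - Real.log (∑ j, Real.exp (u t j))) :=
    fun t => by rw [Real.exp_sub, Real.exp_log (sum_exp_pos _ k), softmax]
  simp_rw [hs t]
  have := ((h k).sub (hasDerivAt_log_sum_exp k h)).exp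
  exact this.congr_of_eventuallyEq (Filter.Eventually.of_forall hs)

end Softmax

section Loss

variable {X : Type*} {m c : ℕ} {z : X → EuclideanSpace ℝ (Fin m) → Fin c → ℝ}

theorem loss_eq (p : X × Fin c) (θ : EuclideanSpace ℝ (Fin m)) :
    loss z p θ = Real.log (∑ j, Real.exp (z p.1 θ j)) - z p.1 θ p.2 :=
  neg_log_softmax _ _

theorem loss_nonneg (p : X × Fin c) (θ : EuclideanSpace ℝ (Fin m)) : 0 ≤ loss z p θ := by
  refine neg_nonneg.2 (Real.log_nonpos (softmax_nonneg _ _) ?_)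
  rw [← sum_softmax (z p.1 θ) p.2]
  exact Finset.single_le_sum (fun k _ => softmax_nonneg _ k) (Finset.mem_univ _)

theorem contDiff_loss (hz : ∀ x, ContDiff ℝ 2 (z x)) (p : X × Fin c) :
    ContDiff ℝ 2 (loss z p) := by
  have hk : ∀ k, ContDiff ℝ 2 fun θ => z p.1 θ k := contDiff_pi.1 (hz p.1)
  have : loss z p = fun θ => Real.log (∑ j, Real.exp (z p.1 θ j)) - z p.1 θ p.2 :=
    funext (loss_eq p)
  rw [this]
  exact ((ContDiff.sum fun j _ => (hk j).exp).log fun θ => (sum_exp_pos _ p.2).ne').sub (hk p.2)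

theorem measurable_loss [MeasurableSpace X] (hzm : ∀ θ, Measurable fun x => z x θ)
    (hz : ∀ x, ContDiff ℝ 2 (z x)) : Measurable (Function.uncurry (loss z)) := by
  have h1 : ∀ θ, Measurable fun p : X × Fin c => loss z p θ := by
    intro θ
    refine measurable_from_prod_countable_left fun y => ?_
    simp only [loss_eq]
    have hk : ∀ k, Measurable fun x => z x θ k := fun k => (measurable_pi_apply k).comp (hzm θ)
    exact ((Finset.measurable_sum _ fun j _ => (hk j).exp).log).sub (hk y)
  exact (measurable_uncurry_of_continuous_of_measurable (u := fun θ p => loss z p θ)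
    (fun p => (contDiff_loss hz p).continuous) h1).comp measurable_swap

/-- Gauss–Newton decomposition of the second derivative of the cross-entropy loss: the first two
terms are the Fisher part, the last one is the residual part. -/
theorem iteratedFDeriv_two_loss (hz : ∀ x, ContDiff ℝ 2 (z x)) (p : X × Fin c)
    (θ v : EuclideanSpace ℝ (Fin m)) :
    (iteratedFDeriv ℝ 2 (loss z p) θ fun _ => v) =
      ∑ k, softmax (z p.1 θ) k * (fderiv ℝ (fun θ' => z p.1 θ' k) θ v) ^ 2
      - (∑ k, softmax (z p.1 θ) k * fderiv ℝ (fun θ' => z p.1 θ' k) θ v) ^ 2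
      + ∑ k, (softmax (z p.1 θ) k - (Pi.single p.2 1 : Fin c → ℝ) k) *
          iteratedFDeriv ℝ 2 (fun θ' => z p.1 θ' k) θ fun _ => v := by
  have hk : ∀ k, ContDiff ℝ 2 fun θ => z p.1 θ k := contDiff_pi.1 (hz p.1)
  have hl := contDiff_loss hz p
  set u : ℕ → ℝ → Fin c → ℝ := fun i t k =>
    iteratedFDeriv ℝ i (fun θ' => z p.1 θ' k) (θ + t • v) fun _ => v with hu
  have d0 : ∀ t k, HasDerivAt (fun t => u 0 t k) (u 1 t k) t := fun t k =>
    hasDerivAt_iteratedFDeriv_line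
      (((hk k).differentiable_iteratedFDeriv (m := 0) (by norm_num)) _)
  have d1 : ∀ t k, HasDerivAt (fun t => u 1 t k) (u 2 t k) t := fun t k =>
    hasDerivAt_iteratedFDeriv_line
      (((hk k).differentiable_iteratedFDeriv (m := 1) (by norm_num)) _)
  set φ : ℕ → ℝ → ℝ := fun i t =>
    iteratedFDeriv ℝ i (loss z p) (θ + t • v) fun _ => v with hφ
  have e0 : ∀ t, HasDerivAt (φ 0) (φ 1 t) t := fun t =>
    hasDerivAt_iteratedFDeriv_line
      ((hl.differentiable_iteratedFDeriv (m := 0) (by norm_num)) _)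
  have e1 : ∀ t, HasDerivAt (φ 1) (φ 2 t) t := fun t =>
    hasDerivAt_iteratedFDeriv_line
      ((hl.differentiable_iteratedFDeriv (m := 1) (by norm_num)) _)
  have hφ0 : φ 0 = fun t => Real.log (∑ j, Real.exp (u 0 t j)) - u 0 t p.2 := by
    funext t
    simp only [hφ, hu, iteratedFDeriv_zero_apply]
    exact loss_eq p _
  have hφ1 : φ 1 = fun t => ∑ k, softmax (u 0 t) k * u 1 t k - u 1 t p.2 := by
    funext t
    have := (hasDerivAt_log_sum_exp p.2 (d0 t)).sub (d0 t p.2)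
    exact (e0 t).unique (hφ0 ▸ this)
  have hφ2 : φ 2 0 = ∑ k, (softmax (u 0 0) k * (u 1 0 k - ∑ j, softmax (u 0 0) j * u 1 0 j)
      * u 1 0 k + softmax (u 0 0) k * u 2 0 k) - u 2 0 p.2 := by
    have h3 : HasDerivAt (fun t => ∑ k, softmax (u 0 t) k * u 1 t k - u 1 t p.2)
        (∑ k, (softmax (u 0 0) k * (u 1 0 k - ∑ j, softmax (u 0 0) j * u 1 0 j)
          * u 1 0 k + softmax (u 0 0) k * u 2 0 k) - u 2 0 p.2) 0 :=
      (HasDerivAt.fun_sum fun k _ => (hasDerivAt_softmax (d0 0) k).mul (d1 0 k)).sub (d1 0 p.2)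
    exact (e1 0).unique (hφ1 ▸ h3)
  have hu0 : u 0 0 = z p.1 θ := by funext k; simp [hu]
  have hu1 : ∀ k, u 1 0 k = fderiv ℝ (fun θ' => z p.1 θ' k) θ v := fun k => by
    simp [hu, iteratedFDeriv_one_apply]
  have hu2 : ∀ k, u 2 0 k = iteratedFDeriv ℝ 2 (fun θ' => z p.1 θ' k) θ fun _ => v :=
    fun k => by simp [hu]
  have hL : φ 2 0 = iteratedFDeriv ℝ 2 (loss z p) θ fun _ => v := by simp [hφ]
  rw [← hL, hφ2, hu0]
  simp_rw [← hu1, ← hu2]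
  set μ := ∑ j, softmax (z p.1 θ) j * u 1 0 j with hμ
  have hy : ∑ k, (Pi.single p.2 1 : Fin c → ℝ) k * u 2 0 k = u 2 0 p.2 := by
    simp [Pi.single_apply]
  simp_rw [sub_mul]
  rw [Finset.sum_sub_distrib (f := fun k => softmax (z p.1 θ) k * u 2 0 k), hy,
    Finset.sum_add_distrib]
  have : ∑ k, softmax (z p.1 θ) k * (u 1 0 k - μ) * u 1 0 k =
      ∑ k, softmax (z p.1 θ) k * u 1 0 k ^ 2 - μ ^ 2 := by
    rw [sq μ]
    nth_rewrite 2 [hμ]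
    rw [Finset.sum_mul, ← Finset.sum_sub_distrib]
    exact Finset.sum_congr rfl fun k _ => by ring
  rw [this]; ring

open scoped Matrix in
theorem trace_fisher_summand (J : Matrix (Fin c) (Fin m) ℝ) (f : Fin c → ℝ) :
    (Jᵀ * (Matrix.diagonal f - Matrix.vecMulVec f f) * J).trace =
      ∑ a, (∑ k, f k * J k a ^ 2 - (∑ k, f k * J k a) ^ 2) := by
  refine Finset.sum_congr rfl fun a _ => ?_
  rw [Matrix.diag_apply, Matrix.mul_sub, Matrix.sub_mul, Matrix.sub_apply]
  congr 1
  · rw [Matrix.mul_apply]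
    simp only [Matrix.mul_diagonal, Matrix.transpose_apply]
    exact Finset.sum_congr rfl fun k _ => by ring
  · rw [sq, Finset.sum_mul_sum, Matrix.mul_apply]
    simp only [Matrix.mul_apply, Matrix.vecMulVec_apply, Matrix.transpose_apply, Finset.sum_mul]
    rw [Finset.sum_comm]
    exact Finset.sum_congr rfl fun k _ => Finset.sum_congr rfl fun l _ => by ring

theorem hessian_diag (g : EuclideanSpace ℝ (Fin m) → ℝ) (θ : EuclideanSpace ℝ (Fin m))
    (a : Fin m) : (hessian g θ).diag a = iteratedFDeriv ℝ 2 g θ fun _ => stdBasis a := by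
  have : ![stdBasis a, stdBasis a] = fun _ => stdBasis a := by
    funext i; fin_cases i <;> rfl
  rw [← this]; rfl

/-- Summing the Gauss–Newton decomposition over the coordinate directions. -/
theorem trace_hessian_loss (hz : ∀ x, ContDiff ℝ 2 (z x)) (p : X × Fin c)
    (θ : EuclideanSpace ℝ (Fin m)) :
    (hessian (loss z p) θ).trace =
      ((jacobian z p.1 θ).transpose * (Matrix.diagonal (softmax (z p.1 θ)) -
        Matrix.vecMulVec (softmax (z p.1 θ)) (softmax (z p.1 θ))) * jacobian z p.1 θ).trace
      + (∑ k, (softmax (z p.1 θ) k - (Pi.single p.2 1 : Fin c → ℝ) k) •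
        hessian (fun θ' => z p.1 θ' k) θ).trace := by
  rw [trace_fisher_summand, Matrix.trace_sum]
  simp only [Matrix.trace, Matrix.diag_smul, Pi.smul_apply, hessian_diag, smul_eq_mul]
  rw [Finset.sum_comm (s := (Finset.univ : Finset (Fin c))), ← Finset.sum_add_distrib]
  exact Finset.sum_congr rfl fun a _ => iteratedFDeriv_two_loss hz p θ (stdBasis a)

variable {n : ℕ}

theorem mean_trace_hessian_loss (hz : ∀ x, ContDiff ℝ 2 (z x)) (S : Fin n → X × Fin c)
    (θ : EuclideanSpace ℝ (Fin m)) :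
    (1 / (n : ℝ)) * ∑ i, (hessian (loss z (S i)) θ).trace =
      (fisher z S θ).trace + (residual z S θ).trace := by
  simp_rw [trace_hessian_loss hz]
  rw [fisher, residual, Matrix.trace_smul, Matrix.trace_smul, Matrix.trace_sum, Matrix.trace_sum,
    Finset.sum_add_distrib, mul_add]
  rfl

theorem isHermitian_fisher (S : Fin n → X × Fin c) (θ : EuclideanSpace ℝ (Fin m)) :
    (fisher z S θ).IsHermitian := by
  rw [Matrix.IsHermitian, Matrix.conjTranspose_eq_transpose_of_trivial, fisher,
    Matrix.transpose_smul, Matrix.transpose_sum]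
  congr 1
  refine Finset.sum_congr rfl fun i _ => ?_
  rw [Matrix.transpose_mul, Matrix.transpose_mul, Matrix.transpose_transpose,
    Matrix.transpose_sub, Matrix.diagonal_transpose, Matrix.transpose_vecMulVec, Matrix.mul_assoc]

theorem trace_fisher_nonneg (S : Fin n → X × Fin c) (θ : EuclideanSpace ℝ (Fin m)) :
    0 ≤ (fisher z S θ).trace := by
  rw [fisher, Matrix.trace_smul, Matrix.trace_sum]
  refine smul_nonneg (by positivity) (Finset.sum_nonneg fun i _ => ?_)
  rw [trace_fisher_summand]
  refine Finset.sum_nonneg fun a _ => sub_nonneg.2 ?_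
  exact Real.pow_arith_mean_le_arith_mean_pow_of_even _ _ _ (fun k _ => softmax_nonneg _ k)
    (sum_softmax _ (S i).2) even_two

theorem trace_le_mul_lambdaMax {A : Matrix (Fin m) (Fin m) ℝ} (hA : A.IsHermitian) :
    A.trace ≤ m * lambdaMax A := by
  have hspec := hA.spectrum_real_eq_range_eigenvalues
  have hle : ∀ i, hA.eigenvalues i ≤ lambdaMax A := fun i => by
    rw [lambdaMax, hspec]
    exact le_csSup (Set.finite_range _).bddAbove ⟨i, rfl⟩
  have := Finset.sum_le_sum fun i (_ : i ∈ Finset.univ) => hle i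
  rw [hA.trace_eq_sum_eigenvalues]
  simpa using this

theorem trace_le_mul_specNorm (A : Matrix (Fin m) (Fin m) ℝ) : A.trace ≤ m * specNorm A := by
  have hle : ∀ i, A.diag i ≤ specNorm A := fun i => by
    have h1 : A.diag i = (Matrix.toEuclideanCLM (𝕜 := ℝ) A (stdBasis i)) i := by
      simp [Matrix.ofLp_toEuclideanCLM]
    rw [h1]
    refine (le_abs_self _).trans ?_
    rw [← Real.norm_eq_abs]
    refine (PiLp.norm_apply_le _ i).trans ?_
    have := (Matrix.toEuclideanCLM (𝕜 := ℝ) A).le_opNorm (stdBasis i)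
    simpa [specNorm] using this
  have := Finset.sum_le_sum fun i (_ : i ∈ Finset.univ) => hle i
  rw [Matrix.trace]
  simpa using this

end Loss

/-! ### Gaussian smoothing of the loss -/

variable {X : Type*} {m c n : ℕ} {z : X → EuclideanSpace ℝ (Fin m) → Fin c → ℝ} {L C : ℝ}

/-- Average of the loss at `p` over Gaussian perturbations `θ + s g`, `g` standard Gaussian. -/
def smoothedLoss (z : X → EuclideanSpace ℝ (Fin m) → Fin c → ℝ) (s : ℝ)
    (θ : EuclideanSpace ℝ (Fin m)) (p : X × Fin c) : ℝ :=
  ∫ x, loss z p (θ + s • WithLp.toLp 2 x) ∂(Measure.pi fun _ : Fin m => gaussianReal 0 1)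

theorem abs_smoothedLoss_sub_le (hz : ∀ x, ContDiff ℝ 2 (z x)) (hL : ∀ p θ, |loss z p θ| ≤ L)
    (h3 : ∀ p, Differentiable ℝ (iteratedFDeriv ℝ 2 (loss z p)))
    (hC : ∀ p θ i j k, |thirdPartial (loss z p) θ i j k| ≤ C) (hC0 : 0 ≤ C)
    (θ : EuclideanSpace ℝ (Fin m)) {s : ℝ} (hs : 0 ≤ s) (p : X × Fin c) :
    |smoothedLoss z s θ p - loss z p θ - s ^ 2 / 2 * (hessian (loss z p) θ).trace|
      ≤ C * s ^ 3 / 6 * (4 / 5 * ((m : ℝ) ^ 3 + m ^ 2)) :=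
  abs_integral_gaussian_sub_le (contDiff_loss hz p) (h3 p) (hC p) hC0 (hL p) θ hs

theorem mean_smoothedLoss_le (hn : 0 < n) (hz : ∀ x, ContDiff ℝ 2 (z x))
    (hL : ∀ p θ, |loss z p θ| ≤ L)
    (h3 : ∀ p, Differentiable ℝ (iteratedFDeriv ℝ 2 (loss z p)))
    (hC : ∀ p θ i j k, |thirdPartial (loss z p) θ i j k| ≤ C) (hC0 : 0 ≤ C)
    (S : Fin n → X × Fin c) (θ : EuclideanSpace ℝ (Fin m)) {s : ℝ} (hs : 0 ≤ s) :
    (1 / (n : ℝ)) * ∑ i, smoothedLoss z s θ (S i) ≤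
      empLoss z S θ + s ^ 2 / 2 * (m * (lambdaMax (fisher z S θ) + specNorm (residual z S θ)))
        + C * s ^ 3 / 6 * (4 / 5 * ((m : ℝ) ^ 3 + m ^ 2)) := by
  have hn' : (n : ℝ) ≠ 0 := by exact_mod_cast hn.ne'
  set κ := C * s ^ 3 / 6 * (4 / 5 * ((m : ℝ) ^ 3 + m ^ 2)) with hκ
  have h1 : ∑ i, smoothedLoss z s θ (S i) ≤
      ∑ i, (loss z (S i) θ + s ^ 2 / 2 * (hessian (loss z (S i)) θ).trace + κ) :=
    Finset.sum_le_sum fun i _ => by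
      linarith [(abs_le.1 (abs_smoothedLoss_sub_le hz hL h3 hC hC0 θ hs (S i))).2]
  have h2 : (1 / (n : ℝ)) * ∑ i, (loss z (S i) θ + s ^ 2 / 2 * (hessian (loss z (S i)) θ).trace + κ)
      = empLoss z S θ + s ^ 2 / 2 * ((fisher z S θ).trace + (residual z S θ).trace) + κ := by
    rw [← mean_trace_hessian_loss hz, empLoss, Finset.sum_add_distrib, Finset.sum_add_distrib,
      ← Finset.mul_sum]
    simp only [Finset.sum_const, Finset.card_univ, Fintype.card_fin, nsmul_eq_mul]
    field_simp
  have h3 : (fisher z S θ).trace + (residual z S θ).trace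
      ≤ m * (lambdaMax (fisher z S θ) + specNorm (residual z S θ)) := by
    linarith [trace_le_mul_lambdaMax (isHermitian_fisher (z := z) S θ),
      trace_le_mul_specNorm (residual z S θ)]
  have h4 := mul_le_mul_of_nonneg_left h3 (show 0 ≤ s ^ 2 / 2 by positivity)
  have h5 := mul_le_mul_of_nonneg_left h1 (show 0 ≤ 1 / (n : ℝ) by positivity)
  linarith

variable [MeasurableSpace X] {D : Measure (X × Fin c)} [IsProbabilityMeasure D]

theorem measurable_loss_shift (hzm : ∀ θ, Measurable fun x => z x θ)
    (hz : ∀ x, ContDiff ℝ 2 (z x)) (θ : EuclideanSpace ℝ (Fin m)) (s : ℝ) :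
    Measurable fun q : (X × Fin c) × (Fin m → ℝ) =>
      loss z q.1 (θ + s • WithLp.toLp 2 q.2) :=
  (measurable_loss hzm hz).comp
    (f := fun q : (X × Fin c) × (Fin m → ℝ) => (q.1, θ + s • WithLp.toLp 2 q.2)) (by fun_prop)

theorem integrable_loss_shift (hzm : ∀ θ, Measurable fun x => z x θ)
    (hz : ∀ x, ContDiff ℝ 2 (z x)) (hL : ∀ p θ, |loss z p θ| ≤ L)
    (θ : EuclideanSpace ℝ (Fin m)) (s : ℝ) (μ : Measure (Fin m → ℝ)) [IsProbabilityMeasure μ] :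
    Integrable (fun q : (X × Fin c) × (Fin m → ℝ) => loss z q.1 (θ + s • WithLp.toLp 2 q.2))
      (D.prod μ) :=
  Integrable.of_bound (measurable_loss_shift hzm hz θ s).aestronglyMeasurable L
    (ae_of_all _ fun _ => hL _ _)

theorem integral_popLoss_eq (hzm : ∀ θ, Measurable fun x => z x θ)
    (hz : ∀ x, ContDiff ℝ 2 (z x)) (hL : ∀ p θ, |loss z p θ| ≤ L)
    (θ : EuclideanSpace ℝ (Fin m)) (s : ℝ) :
    ∫ x, popLoss z D (θ + s • WithLp.toLp 2 x) ∂(Measure.pi fun _ : Fin m => gaussianReal 0 1)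
      = ∫ p, smoothedLoss z s θ p ∂D :=
  (integral_integral_swap (integrable_loss_shift (D := D) hzm hz hL θ s
    (Measure.pi fun _ : Fin m => gaussianReal 0 1))).symm

theorem measurable_popLoss (hzm : ∀ θ, Measurable fun x => z x θ)
    (hz : ∀ x, ContDiff ℝ 2 (z x)) : Measurable (popLoss z D) :=
  ((measurable_loss hzm hz).stronglyMeasurable.integral_prod_left (μ := D)).measurable

theorem integrable_loss (hzm : ∀ θ, Measurable fun x => z x θ)
    (hz : ∀ x, ContDiff ℝ 2 (z x)) (hL : ∀ p θ, |loss z p θ| ≤ L)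
    (θ : EuclideanSpace ℝ (Fin m)) : Integrable (fun p => loss z p θ) D :=
  Integrable.of_bound
    ((measurable_loss hzm hz).comp (measurable_id.prodMk measurable_const)).aestronglyMeasurable L
    (ae_of_all _ fun _ => hL _ _)

theorem popLoss_le (hzm : ∀ θ, Measurable fun x => z x θ) (hz : ∀ x, ContDiff ℝ 2 (z x))
    (hL : ∀ p θ, |loss z p θ| ≤ L) (θ : EuclideanSpace ℝ (Fin m)) : popLoss z D θ ≤ L := by
  have := integral_mono (integrable_loss (D := D) hzm hz hL θ) (integrable_const L)
    fun p => (le_abs_self _).trans (hL p θ)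
  simpa [popLoss] using this

/-- If `θ` is not improved by averaging over `N(0, σ² I)`, then averaging over the narrower
`N(0, (σ / 2)² I)` improves it only by a third-order term. Combining the second-order expansions
at both widths eliminates the trace of the Hessian. -/
theorem popLoss_le_integral_smoothedLoss_half (hzm : ∀ θ, Measurable fun x => z x θ)
    (hz : ∀ x, ContDiff ℝ 2 (z x)) (hL : ∀ p θ, |loss z p θ| ≤ L)
    (h3 : ∀ p, Differentiable ℝ (iteratedFDeriv ℝ 2 (loss z p)))
    (hC : ∀ p θ i j k, |thirdPartial (loss z p) θ i j k| ≤ C) (hC0 : 0 ≤ C)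
    (θ : EuclideanSpace ℝ (Fin m)) {σ : ℝ} (hσ : 0 ≤ σ)
    (hθ : popLoss z D θ ≤ ∫ p, smoothedLoss z σ θ p ∂D) :
    popLoss z D θ ≤ ∫ p, smoothedLoss z (σ / 2) θ p ∂D
      + 3 / 8 * (C * σ ^ 3 / 6 * (4 / 5 * ((m : ℝ) ^ 3 + m ^ 2))) := by
  set κ := C * σ ^ 3 / 6 * (4 / 5 * ((m : ℝ) ^ 3 + m ^ 2)) with hκ
  have hi : ∀ s, Integrable (smoothedLoss z s θ) D := fun s =>
    (integrable_loss_shift (D := D) hzm hz hL θ s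
      (Measure.pi fun _ : Fin m => gaussianReal 0 1)).integral_prod_left
  have hl := integrable_loss (D := D) hzm hz hL θ
  have hp : ∀ p, 3 / 4 * loss z p θ + 1 / 4 * smoothedLoss z σ θ p
      ≤ smoothedLoss z (σ / 2) θ p + 3 / 8 * κ := fun p => by
    have h1 := (abs_le.1 (abs_smoothedLoss_sub_le hz hL h3 hC hC0 θ hσ p)).2
    have h2 := (abs_le.1 (abs_smoothedLoss_sub_le hz hL h3 hC hC0 θ
      (show 0 ≤ σ / 2 by linarith) p)).1
    have e1 : C * (σ / 2) ^ 3 / 6 * (4 / 5 * ((m : ℝ) ^ 3 + m ^ 2)) = κ / 8 := by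
      rw [hκ]; ring
    have e2 : (σ / 2) ^ 2 / 2 * (hessian (loss z p) θ).trace
        = 1 / 4 * (σ ^ 2 / 2 * (hessian (loss z p) θ).trace) := by ring
    rw [e1, e2] at h2
    linarith
  have h := integral_mono ((hl.const_mul (3 / 4)).add ((hi σ).const_mul (1 / 4)))
    ((hi (σ / 2)).add (integrable_const (3 / 8 * κ))) hp
  simp only [Pi.add_apply] at h
  rw [integral_add (hl.const_mul _) ((hi σ).const_mul _), integral_const_mul, integral_const_mul,
    integral_add (hi _) (integrable_const _), integral_const] at h
  simp only [probReal_univ, one_smul] at h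
  change 3 / 4 * popLoss z D θ + _ ≤ _ at h
  linarith

/-- The PAC-Bayes bound for Gaussian perturbations of the parameter. -/
theorem exists_event_integral_smoothedLoss_le (hn : 0 < n) (hm : 0 < m) (hLpos : 0 < L)
    (hzm : ∀ θ, Measurable fun x => z x θ) (hz : ∀ x, ContDiff ℝ 2 (z x))
    (hL : ∀ p θ, |loss z p θ| ≤ L) {N : ℕ} (hN : 0 < N) {s : ℝ} (hs : 0 < s) {ξ : ℝ}
    (hξ : 0 < ξ) (hξ1 : ξ < 1) :
    ∃ E : Set (Fin n → X × Fin c), MeasurableSet E ∧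
      ENNReal.ofReal (1 - ξ) ≤ Measure.pi (fun _ : Fin n => D) E ∧
      ∀ S ∈ E, ∀ θ : EuclideanSpace ℝ (Fin m),
        m * Real.log (1 + ‖θ‖ ^ 2 / (m * s ^ 2)) ≤ (N : ℝ) - 1 →
        ∫ p, smoothedLoss z s θ p ∂D ≤ (1 / (n : ℝ)) * ∑ i, smoothedLoss z s θ (S i) +
          L / (2 * Real.sqrt n) * Real.sqrt
            (m * Real.log (1 + ‖θ‖ ^ 2 / (m * s ^ 2)) + 1 + 2 * Real.log (1 / ξ)
              + 2 * Real.log N) := by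
  lift s to ℝ≥0 using hs.le
  have hℓ : Measurable (Function.uncurry fun (p : X × Fin c) (x : Fin m → ℝ) =>
      loss z p (WithLp.toLp 2 x)) :=
    (measurable_loss hzm hz).comp
      (f := fun q : (X × Fin c) × (Fin m → ℝ) => (q.1, WithLp.toLp 2 q.2)) (by fun_prop)
  obtain ⟨E, hE, hPE, hb⟩ := exists_event_integral_gap_le (D := D) (n := n) hn hm hLpos hℓ
    (fun p x => ⟨loss_nonneg _ _, (le_abs_self _).trans (hL _ _)⟩) hN
    (s := s) (by exact_mod_cast hs.ne') hξ hξ1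
  refine ⟨E, hE, hPE, fun S hS θ hθ => ?_⟩
  have h := hb S hS θ
  simp only [← EuclideanSpace.real_norm_sq_eq] at h
  have h' := h hθ
  have hgm : Measurable fun x : Fin m → ℝ =>
      gap D (fun (p : X × Fin c) (x : Fin m → ℝ) => loss z p (WithLp.toLp 2 x)) S x :=
    (measurable_gap hℓ).comp (measurable_const.prodMk measurable_id)
  rw [integral_pi_gaussianReal_eq_standard _ _ hgm] at h'
  have hshift : ∀ x : Fin m → ℝ,
      WithLp.toLp 2 (fun i => θ i + s * x i) = θ + (s : ℝ) • WithLp.toLp 2 x :=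
    fun x => by ext i; simp
  have hI : ∫ x, gap D (fun (p : X × Fin c) (x : Fin m → ℝ) => loss z p (WithLp.toLp 2 x)) S
        (fun i => θ i + s * x i)
        ∂(Measure.pi fun _ : Fin m => gaussianReal 0 1)
      = ∫ p, smoothedLoss z s θ p ∂D - (1 / (n : ℝ)) * ∑ i, smoothedLoss z s θ (S i) := by
    simp only [gap, hshift]
    have hi : ∀ i, Integrable (fun x : Fin m → ℝ => loss z (S i) (θ + (s : ℝ) • WithLp.toLp 2 x))
        (Measure.pi fun _ : Fin m => gaussianReal 0 1) := fun i =>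
      Integrable.of_bound ((contDiff_loss hz (S i)).continuous.comp
        (by fun_prop)).aestronglyMeasurable L (ae_of_all _ fun x => hL _ _)
    have hpop : Integrable
        (fun x : Fin m → ℝ => ∫ p, loss z p (θ + (s : ℝ) • WithLp.toLp 2 x) ∂D)
        (Measure.pi fun _ : Fin m => gaussianReal 0 1) :=
      (integrable_loss_shift (D := D) hzm hz hL θ s _).integral_prod_right
    rw [integral_sub hpop ((integrable_finsetSum _ fun i _ => hi i).const_mul _),
      integral_const_mul, integral_finsetSum _ fun i _ => hi i,
      ← integral_popLoss_eq (D := D) hzm hz hL θ s]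
    rfl
  rw [hI] at h'
  linarith

end FIMBound

end

/-! ### The generalization bound -/

theorem theorem1 :
    -- `K` is the absolute constant hidden in `O(1)`
    ∃ K : ℝ,
      ∀ (X : Type*) [MeasurableSpace X] (m c n : ℕ), 0 < n →
      ∀ (D : Measure (X × Fin c)) [IsProbabilityMeasure D]
        (z : X → EuclideanSpace ℝ (Fin m) → Fin c → ℝ) (L C : ℝ),
        (∀ θ, Measurable fun x => z x θ) →
        (∀ x, ContDiff ℝ 2 (z x)) →
        -- the loss is bounded by `L`
        (∀ p θ, |FIMBound.loss z p θ| ≤ L) →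
        -- the loss is three times differentiable, with third-order partials bounded by `C`
        (∀ p, Differentiable ℝ (iteratedFDeriv ℝ 2 (FIMBound.loss z p))) →
        (∀ p θ i j k, |FIMBound.thirdPartial (FIMBound.loss z p) θ i j k| ≤ C) →
        ∀ ξ ρ σ : ℝ, 0 < ξ → ξ < 1 → 0 < ρ → ρ = Real.sqrt m * σ →
        -- with probability at least `1 - ξ` over the i.i.d. sample `S`
        ∃ E : Set (Fin n → X × Fin c), MeasurableSet E ∧
          ENNReal.ofReal (1 - ξ) ≤ Measure.pi (fun _ : Fin n => D) E ∧
          ∀ S ∈ E, ∀ θ : EuclideanSpace ℝ (Fin m),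
            FIMBound.popLoss z D θ
              ≤ ∫ ε, FIMBound.popLoss z D (θ + ε) ∂(FIMBound.isoGaussian m σ) →
            ∀ εR : ℝ, FIMBound.specNorm (FIMBound.residual z S θ) ≤ εR →
            FIMBound.popLoss z D θ ≤ FIMBound.empLoss z S θ
              + ρ ^ 2 / 2 * (FIMBound.lambdaMax (FIMBound.fisher z S θ) + εR)
              + C * (m : ℝ) ^ (3 / 2 : ℝ) * ρ ^ 3 / 6
              + L / (2 * Real.sqrt n)
                * Real.sqrt (m * Real.log (1 + ‖θ‖ ^ 2 / ρ ^ 2) + 2 * Real.log (1 / ξ)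
                  + 4 * Real.log ((n : ℝ) + m) + K) := by
  -- Under the root the argument gives `m log (1 + ‖θ‖² / ρ²) + 5 + 1 + 2 log (1 / ξ)
  -- + 2 log (4 n + 6)`, and `log (4 n + 6) ≤ log 16 + log (n + m)` with `6 + 2 log 16 < 12`.
  refine ⟨12, fun X _ m c n hn D _ z L C hzm hz hL h3 hC ξ ρ σ hξ hξ1 hρ hρσ => ?_⟩
  have hn' : (1 : ℝ) ≤ n := by exact_mod_cast hn
  have hm : 0 < m := by
    rcases Nat.eq_zero_or_pos m with rfl | h
    · simp [hρσ] at hρ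
    · exact h
  have hm' : (1 : ℝ) ≤ m := by exact_mod_cast hm
  have hσ : 0 < σ := by
    rw [hρσ] at hρ
    exact pos_of_mul_pos_right hρ (Real.sqrt_nonneg _)
  have hρ2 : ρ ^ 2 = m * σ ^ 2 := by
    rw [hρσ, mul_pow, Real.sq_sqrt (by linarith)]
  obtain ⟨p₀⟩ : Nonempty (X × Fin c) := nonempty_of_isProbabilityMeasure D
  have hC0 : 0 ≤ C := (abs_nonneg _).trans (hC p₀ 0 ⟨0, hm⟩ ⟨0, hm⟩ ⟨0, hm⟩)
  have hL0 : 0 ≤ L := (abs_nonneg _).trans (hL p₀ 0)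
  have hlogξ : 0 < Real.log (1 / ξ) := Real.log_pos (by rw [lt_div_iff₀ hξ]; linarith)
  have hlognm : 0 ≤ Real.log ((n : ℝ) + m) := Real.log_nonneg (by linarith)
  have hlog2 := Real.log_two_lt_d9
  have hlog4 : Real.log 4 = 2 * Real.log 2 := by
    rw [show (4 : ℝ) = 2 ^ 2 by norm_num, Real.log_pow]; norm_num
  have hlog16 : Real.log 16 = 4 * Real.log 2 := by
    rw [show (16 : ℝ) = 2 ^ 4 by norm_num, Real.log_pow]; norm_num
  -- the third-order term of the statement
  have hcube : C * (m : ℝ) ^ (3 / 2 : ℝ) * ρ ^ 3 / 6 = C * σ ^ 3 / 6 * (m : ℝ) ^ 3 := by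
    have h1 : (m : ℝ) ^ (3 / 2 : ℝ) = Real.sqrt m ^ 3 := by
      rw [Real.sqrt_eq_rpow, ← Real.rpow_natCast, ← Real.rpow_mul (by linarith)]
      norm_num
    have h2 : (m : ℝ) ^ 3 = Real.sqrt m ^ 3 * Real.sqrt m ^ 3 := by
      rw [← mul_pow, Real.mul_self_sqrt (by linarith)]
    rw [h1, h2, hρσ]; ring
  have hnonneg : ∀ (S : Fin n → X × Fin c) θ εR,
      FIMBound.specNorm (FIMBound.residual z S θ) ≤ εR →
      0 ≤ FIMBound.lambdaMax (FIMBound.fisher z S θ) + εR := fun S θ εR hε => by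
    have h1 := (FIMBound.trace_fisher_nonneg (z := z) S θ).trans
      (FIMBound.trace_le_mul_lambdaMax (FIMBound.isHermitian_fisher S θ))
    have h2 : 0 ≤ FIMBound.lambdaMax (FIMBound.fisher z S θ) :=
      nonneg_of_mul_nonneg_right h1 (by linarith)
    have h3 : 0 ≤ εR := (norm_nonneg _).trans hε
    linarith
  -- the bound is trivial where its last term is at least `L`
  have htriv : ∀ (S : Fin n → X × Fin c) θ εR B,
      FIMBound.specNorm (FIMBound.residual z S θ) ≤ εR → (L ≤ B) →
      FIMBound.popLoss z D θ ≤ FIMBound.empLoss z S θ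
        + ρ ^ 2 / 2 * (FIMBound.lambdaMax (FIMBound.fisher z S θ) + εR)
        + C * (m : ℝ) ^ (3 / 2 : ℝ) * ρ ^ 3 / 6 + B := fun S θ εR B hε hB => by
    have h1 := FIMBound.popLoss_le (D := D) hzm hz hL θ
    have h2 : 0 ≤ FIMBound.empLoss z S θ :=
      mul_nonneg (by positivity) (Finset.sum_nonneg fun i _ => FIMBound.loss_nonneg _ _)
    have h3 := mul_nonneg (show 0 ≤ ρ ^ 2 / 2 by positivity) (hnonneg S θ εR hε)
    have h4 : 0 ≤ C * (m : ℝ) ^ (3 / 2 : ℝ) * ρ ^ 3 / 6 := by positivity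
    linarith
  rcases hL0.eq_or_lt with hL00 | hLpos
  · refine ⟨Set.univ, MeasurableSet.univ, ?_, fun S _ θ _ εR hε => htriv S θ εR _ hε ?_⟩
    · rw [measure_univ]
      exact ENNReal.ofReal_le_one.2 (by linarith)
    · rw [← hL00]; simp
  -- For `m ≥ 4` the posterior has the width `σ` of the hypothesis. For smaller `m` the third
  -- moment of `N(0, σ² I)` is too large, and half the width is used.
  obtain ⟨s, hs, hlogs, hdet⟩ : ∃ s : ℝ, 0 < s ∧
      (∀ θ : EuclideanSpace ℝ (Fin m), m * Real.log (1 + ‖θ‖ ^ 2 / (m * s ^ 2))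
        ≤ m * Real.log (1 + ‖θ‖ ^ 2 / ρ ^ 2) + 5) ∧
      ∀ (S : Fin n → X × Fin c) (θ : EuclideanSpace ℝ (Fin m)) (εR B : ℝ),
        FIMBound.popLoss z D θ ≤ ∫ p, FIMBound.smoothedLoss z σ θ p ∂D →
        FIMBound.specNorm (FIMBound.residual z S θ) ≤ εR →
        ∫ p, FIMBound.smoothedLoss z s θ p ∂D
          ≤ (1 / (n : ℝ)) * ∑ i, FIMBound.smoothedLoss z s θ (S i) + B →
        FIMBound.popLoss z D θ ≤ FIMBound.empLoss z S θ
          + ρ ^ 2 / 2 * (FIMBound.lambdaMax (FIMBound.fisher z S θ) + εR)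
          + C * (m : ℝ) ^ (3 / 2 : ℝ) * ρ ^ 3 / 6 + B := by
    have hκ0 : 0 ≤ C * σ ^ 3 / 6 := by positivity
    rcases le_or_gt 4 m with h4 | h4
    · have h4' : (4 : ℝ) ≤ m := by exact_mod_cast h4
      refine ⟨σ, hσ, fun θ => by rw [hρ2]; linarith, fun S θ εR B hθ hε hB => ?_⟩
      have hemp := FIMBound.mean_smoothedLoss_le hn hz hL h3 hC hC0 S θ hσ.le
      have hκ : C * σ ^ 3 / 6 * (4 / 5 * ((m : ℝ) ^ 3 + m ^ 2)) ≤ C * σ ^ 3 / 6 * (m : ℝ) ^ 3 :=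
        mul_le_mul_of_nonneg_left (by nlinarith [sq_nonneg (m : ℝ)]) hκ0
      have hlam : σ ^ 2 / 2 * (m * (FIMBound.lambdaMax (FIMBound.fisher z S θ)
          + FIMBound.specNorm (FIMBound.residual z S θ))) ≤
          ρ ^ 2 / 2 * (FIMBound.lambdaMax (FIMBound.fisher z S θ) + εR) := by
        rw [hρ2, show m * σ ^ 2 / 2 = σ ^ 2 / 2 * m by ring, mul_assoc]
        gcongr
      rw [hcube]
      linarith
    · have h4' : (m : ℝ) ≤ 3 := by exact_mod_cast Nat.lt_succ_iff.1 h4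
      refine ⟨σ / 2, by linarith, fun θ => ?_, fun S θ εR B hθ hε hB => ?_⟩
      · have e1 : ‖θ‖ ^ 2 / (m * (σ / 2) ^ 2) = 4 * (‖θ‖ ^ 2 / ρ ^ 2) := by
          rw [hρ2]; field_simp; norm_num
        have e2 : 0 ≤ ‖θ‖ ^ 2 / ρ ^ 2 := by positivity
        have e3 : Real.log (1 + ‖θ‖ ^ 2 / (m * (σ / 2) ^ 2))
            ≤ Real.log 4 + Real.log (1 + ‖θ‖ ^ 2 / ρ ^ 2) := by
          rw [← Real.log_mul (by norm_num) (by linarith), e1]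
          exact Real.log_le_log (by linarith) (by linarith)
        have e4 := mul_le_mul_of_nonneg_left e3 (show (0 : ℝ) ≤ m by linarith)
        have e5 : m * Real.log 4 ≤ 3 * Real.log 4 :=
          mul_le_mul_of_nonneg_right h4' (Real.log_nonneg (by norm_num))
        linarith
      · have hemp := FIMBound.mean_smoothedLoss_le hn hz hL h3 hC hC0 S θ
          (show 0 ≤ σ / 2 by linarith)
        have hpop := FIMBound.popLoss_le_integral_smoothedLoss_half hzm hz hL h3 hC hC0 θ hσ.le hθ
        have hκ : 1 / 2 * (C * σ ^ 3 / 6 * (4 / 5 * ((m : ℝ) ^ 3 + m ^ 2)))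
            ≤ C * σ ^ 3 / 6 * (m : ℝ) ^ 3 := by
          have : 1 / 2 * (4 / 5 * ((m : ℝ) ^ 3 + m ^ 2)) ≤ (m : ℝ) ^ 3 := by
            nlinarith [sq_nonneg (m : ℝ)]
          linarith [mul_le_mul_of_nonneg_left this hκ0]
        have e1 : C * (σ / 2) ^ 3 / 6 * (4 / 5 * ((m : ℝ) ^ 3 + m ^ 2))
            = 1 / 8 * (C * σ ^ 3 / 6 * (4 / 5 * ((m : ℝ) ^ 3 + m ^ 2))) := by ring
        have hlam : (σ / 2) ^ 2 / 2 * (m * (FIMBound.lambdaMax (FIMBound.fisher z S θ)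
            + FIMBound.specNorm (FIMBound.residual z S θ))) ≤
            ρ ^ 2 / 2 * (FIMBound.lambdaMax (FIMBound.fisher z S θ) + εR) := by
          rw [hρ2, show (σ / 2) ^ 2 / 2 * (m * (FIMBound.lambdaMax (FIMBound.fisher z S θ)
            + FIMBound.specNorm (FIMBound.residual z S θ))) = m * σ ^ 2 / 8 *
            (FIMBound.lambdaMax (FIMBound.fisher z S θ)
              + FIMBound.specNorm (FIMBound.residual z S θ)) by ring]
          have h1 := hnonneg S θ εR hε
          calc _ ≤ m * σ ^ 2 / 8 * (FIMBound.lambdaMax (FIMBound.fisher z S θ) + εR) := by gcongr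
            _ ≤ _ := mul_le_mul_of_nonneg_right (by nlinarith [sq_nonneg σ]) h1
        rw [hcube]
        rw [e1] at hemp
        linarith
  -- where the bound is not trivial, `m log (1 + ‖θ‖² / ρ²) < 4 n`; the `5` lost to the choice of
  -- `s` still leaves the index of the fitting prior below `4 n + 6`
  obtain ⟨E, hE, hPE, hb⟩ := FIMBound.exists_event_integral_smoothedLoss_le (D := D) hn hm hLpos
    hzm hz hL (show 0 < 4 * n + 6 by omega) hs hξ hξ1
  refine ⟨E, hE, hPE, fun S hS θ hθ εR hε => ?_⟩
  have hsn : 0 < Real.sqrt n := Real.sqrt_pos.2 (by linarith)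
  have hT0 : 0 ≤ m * Real.log (1 + ‖θ‖ ^ 2 / ρ ^ 2) := by
    have : 0 ≤ ‖θ‖ ^ 2 / ρ ^ 2 := by positivity
    exact mul_nonneg (by linarith) (Real.log_nonneg (by linarith))
  rcases le_or_gt (4 * (n : ℝ)) (m * Real.log (1 + ‖θ‖ ^ 2 / ρ ^ 2)) with hbig | hsmall
  · refine htriv S θ εR _ hε ?_
    have h1 : 2 * Real.sqrt n = Real.sqrt (4 * n) := by
      rw [Real.sqrt_mul (by norm_num), show (4 : ℝ) = 2 ^ 2 by norm_num,
        Real.sqrt_sq (by norm_num)]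
    calc L = L / (2 * Real.sqrt n) * Real.sqrt (4 * n) := by rw [← h1]; field_simp
      _ ≤ _ := mul_le_mul_of_nonneg_left (Real.sqrt_le_sqrt (by linarith)) (by positivity)
  · have hθ' : FIMBound.popLoss z D θ ≤ ∫ p, FIMBound.smoothedLoss z σ θ p ∂D := by
      rw [FIMBound.integral_isoGaussian hσ.le (F := fun ε => FIMBound.popLoss z D (θ + ε))
        ((FIMBound.measurable_popLoss hzm hz).comp (measurable_const_add θ))] at hθ
      rwa [← FIMBound.integral_popLoss_eq hzm hz hL θ σ]
    have hlogN : Real.log ((4 * n + 6 : ℕ) : ℝ) ≤ Real.log 16 + Real.log ((n : ℝ) + m) := by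
      rw [← Real.log_mul (by norm_num) (by linarith)]
      refine Real.log_le_log (by positivity) ?_
      push_cast
      linarith
    refine hdet S θ εR _ hθ' hε ((hb S hS θ ?_).trans ?_)
    · push_cast
      linarith [hlogs θ]
    · refine add_le_add_right (mul_le_mul_of_nonneg_left (Real.sqrt_le_sqrt ?_)
        (by positivity)) _
      linarith [hlogs θ]
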